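/- Let $1\le k\le n$ and let $H\subseteq\mathbb{R}^n$ be a $k$-dimensional linear subspace. For a Euclidean space $F$ (here $F=\mathbb{R}^k$ or $F=H$) and a set $K\subseteq F$, let $K^\circ=\{x\in F:\langle x,y\rangle\le 1\text{ for all }y\in K\}$ be the polar of $K$ and let $$\ell(K)=\int_F\|x\|_K\,d\gamma(x),$$ where $\|x\|_K=\inf\{t>0:x\in tK\}$ is the Minkowski functional of $K$ and $\gamma$ is the standard Gaussian probability measure on $F$. Let $\triangle_k\subset\mathbb{R}^k$ be a regular $k$-simplex inscribed in the Euclidean unit ball (the convex hull of $k+1$ affinely independent, pairwise equidistant unit vectors), with polar $\triangle_k^\circ$ taken in $\mathbb{R}^k$. Let $\mu$ be a finite Borel measure on the unit sphere $S^{n-1}\subset\mathbb{R}^n$ that is isotropic, i.e. $\int_{S^{n-1}}u\otimes u\,d\mu(u)=I_n$, and whose centroid $\frac{1}{\mu(S^{n-1})}\int_{S^{n-1}}u\,d\mu(u)$ is the origin. Put $C=\mathrm{conv}(\mathrm{supp}\,\mu)$, with polar $C^\circ$ taken in $\mathbb{R}^n$, and regard $C^\circ\cap H$ as a subset of the Euclidean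 space $H$. Then $$\ell(C^\circ\cap H)\ \ge\ \sqrt{\frac{k}{n}}\;\ell(\triangle_k^\circ),$$ with equality if and only if $C^\circ\cap H=\sqrt{\frac{n}{k}}\,\triangle_k^\circ$ up to a linear isometric identification of $\mathbb{R}^k$ with $H$, i.e. if and only if there is a linear isometry $L$ from $\mathbb{R}^k$ onto $H$ with $C^\circ\cap H=L\big(\sqrt{\frac{n}{k}}\,\triangle_k^\circ\big)$. -/

import Mathlib

open MeasureTheory ProbabilityTheory Metric
open scoped Pointwise RealInnerProductSpace

noncomputable section

/-- A Borel measure on the unit sphere of `ℝⁿ` is isotropic if `∫ u ⊗ u dμ(u)` is the identity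
operator; `InnerProductSpace.rankOne ℝ u u` is the operator `u ⊗ u : x ↦ ⟪u, x⟫ • u`. -/
def IsIsotropic {n : ℕ} (μ : Measure (sphere (0 : EuclideanSpace ℝ (Fin n)) 1)) : Prop :=
  ∫ u, InnerProductSpace.rankOne ℝ (u : EuclideanSpace ℝ (Fin n)) (u : EuclideanSpace ℝ (Fin n)) ∂μ
    = ContinuousLinearMap.id ℝ (EuclideanSpace ℝ (Fin n))

/-- The centroid `μ(S^{n-1})⁻¹ ∫ u dμ(u)` of a measure on the unit sphere. -/
def sphereCentroid {n : ℕ} (μ : Measure (sphere (0 : EuclideanSpace ℝ (Fin n)) 1)) :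
    EuclideanSpace ℝ (Fin n) :=
  (μ.real Set.univ)⁻¹ • ∫ u, (u : EuclideanSpace ℝ (Fin n)) ∂μ

/-- The convex hull `conv (supp μ)` in `ℝⁿ` of the support of a measure on the unit sphere. -/
def convSupport {n : ℕ} (μ : Measure (sphere (0 : EuclideanSpace ℝ (Fin n)) 1)) :
    Set (EuclideanSpace ℝ (Fin n)) :=
  convexHull ℝ (Subtype.val '' μ.support)

/-- The polar `K° = {x | ⟪x, y⟫ ≤ 1 for all y ∈ K}`, taken in the inner product space `F`. -/
def polarBody {F : Type*} [NormedAddCommGroup F] [InnerProductSpace ℝ F] (K : Set F) : Set F :=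
  {x | ∀ y ∈ K, ⟪x, y⟫ ≤ 1}

/-- The section `K ∩ H`, regarded as a subset of the Euclidean space `H`. -/
def sectionIn {F : Type*} [NormedAddCommGroup F] [InnerProductSpace ℝ F] (K : Set F)
    (H : Submodule ℝ F) : Set H :=
  {y | (y : F) ∈ K}

/-- The `ℓ`-norm `ℓ(K) = ∫ ‖x‖_K dγ(x)`, where `‖·‖_K` is the Minkowski functional of `K` and `γ`
is the standard Gaussian probability measure of the Euclidean space `F`. -/
def ellNorm {F : Type*} [NormedAddCommGroup F] [InnerProductSpace ℝ F] [FiniteDimensional ℝ F]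
    [MeasurableSpace F] (K : Set F) : ℝ :=
  ∫ x, gauge K x ∂(stdGaussian F)

/-- The set `D` is a regular `k`-dimensional simplex inscribed in the unit ball of `ℝᵏ`: the convex
hull of `k + 1` affinely independent, pairwise equidistant unit vectors. -/
def IsInscribedRegularSimplex (k : ℕ) (D : Set (EuclideanSpace ℝ (Fin k))) : Prop :=
  ∃ s : Affine.Simplex ℝ (EuclideanSpace ℝ (Fin k)) k,
    s.Equilateral ∧ (∀ i, ‖s.points i‖ = 1) ∧ D = convexHull ℝ (Set.range s.points)

end

/-!
Let `P` be the orthogonal projection to `H`. For `y` in `H` the Minkowski functional of `C° ∩ H` at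
`y` is `sup ⟪P u, y⟫` over the support of `μ`, so `ℓ(C° ∩ H)` is the mean of the supremum of a
Gaussian process. By Carathéodory's theorem (`exists_finite_decomposition`) there are finitely many
points `xᵢ` of the projected support and weights `cᵢ > 0` with `∑ cᵢ = n`, `∑ cᵢ xᵢ = 0` and
`∑ cᵢ xᵢ ⊗ xᵢ = id`. Passing to these points enlarges the polar, hence lowers `ℓ`, and leaves `ℓ`
unchanged only if the polar is unchanged (`polarBody_eq_of_ellNorm_eq`). It thus suffices to treat
`E max ⟪xᵢ, G⟫`.

Lift to `H × ℝ`: the vectors `zᵢ = (xᵢ, 1/√n)` satisfy `∑ cᵢ zᵢ ⊗ zᵢ = id`, and the maximum of the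
`⟪zᵢ, Y⟫` has the same mean, because the added variable is common to all of them and centred
(`integral_maxInner_liftVec`). Write `zᵢ = σᵢ wᵢ` with unit vectors `wᵢ`, `dᵢ = cᵢ σᵢ²` and
`N = k + 1`, so that `∑ dᵢ wᵢ ⊗ wᵢ = id` and `∑ dᵢ = N`. The Gaussian Brascamp–Lieb inequality for
half-lines (`stdGaussian_real_forall_inner_le_prod`) and the inequality of weighted means give

  `P(max σᵢ ⟪wᵢ, Y⟫ ≤ t) ≤ ∏ Φ(t / σᵢ) ^ dᵢ ≤ ∑ (dᵢ / N) Φ(t / σᵢ) ^ N`,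

and integrating in `t` yields `E max ⟪xᵢ, G⟫ ≥ (∑ (dᵢ / N) σᵢ) m_N`, where `m_N` is the mean of the
maximum of `N` independent normal variables (`le_integral_maxInner`). Since `∑ cᵢ = n` and
`∑ cᵢ σᵢ² = N`, the factor is at least `√(N / n)`, with equality only if all `σᵢ` are equal. Lifting
the regular simplex in the same way gives an orthogonal basis, whence `ℓ(△ₖ°) = √(N / k) m_N`
(`integral_maxInner_regularSimplex`), and the inequality follows.

The Brascamp–Lieb inequality is proved by transport: with `Tᵢ` the monotone map from the normal law
conditioned to `(-∞, τᵢ]` to the normal law, change variables by `y ↦ ∑ dᵢ Tᵢ(⟪wᵢ, y⟫) wᵢ`, using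
`det (∑ dᵢ aᵢ wᵢ ⊗ wᵢ) ≥ ∏ aᵢ ^ dᵢ` (`prod_rpow_le_det`).

In the case of equality the distribution function of `max ⟪wᵢ, Y⟫` is `Φ ^ N` at arbitrarily large
arguments (`frequently_distribution_eq`). As the tail of this maximum is asymptotically
`1 - Φ` times the number of distinct `wᵢ`, there are at most `N` of them
(`card_le_of_frequently_distribution_eq`); a decomposition of the identity by that few unit vectors
is an orthonormal basis, so the `xᵢ` are the vertices of a regular simplex, which a linear isometry
identifies with the given one (`exists_polarBody_eq_image`).
-/

/-! ### The standard normal law and the standard Gaussian measure -/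

/-- The distribution function of the standard normal law on `ℝ`. -/
noncomputable def normalCDF (t : ℝ) : ℝ := (gaussianReal 0 1).real (Set.Iic t)

lemma normalCDF_eq_integral (t : ℝ) :
    normalCDF t = ∫ x in Set.Iic t, gaussianPDFReal 0 1 x := by
  rw [normalCDF, measureReal_def, gaussianReal_apply_eq_integral 0 one_ne_zero,
    ENNReal.toReal_ofReal]
  exact integral_nonneg fun x => gaussianPDFReal_nonneg 0 1 x

lemma normalCDF_sub (s t : ℝ) :
    normalCDF t - normalCDF s = ∫ x in s..t, gaussianPDFReal 0 1 x := by
  rw [normalCDF_eq_integral, normalCDF_eq_integral]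
  exact intervalIntegral.integral_Iic_sub_Iic (integrable_gaussianPDFReal 0 1).integrableOn
    (integrable_gaussianPDFReal 0 1).integrableOn

lemma gaussianPDFReal_std_eq (x : ℝ) :
    gaussianPDFReal 0 1 x = (√(2 * Real.pi))⁻¹ * Real.exp (-(1 / 2) * x ^ 2) := by
  simp only [gaussianPDFReal, NNReal.coe_one, mul_one, sub_zero]; ring_nf

lemma continuous_gaussianPDFReal_std : Continuous (gaussianPDFReal 0 1) := by
  unfold gaussianPDFReal
  fun_prop

lemma hasStrictDerivAt_normalCDF (t : ℝ) :
    HasStrictDerivAt normalCDF (gaussianPDFReal 0 1 t) t := by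
  have h : normalCDF = fun u => normalCDF 0 + ∫ x in (0 : ℝ)..u, gaussianPDFReal 0 1 x := by
    ext u
    rw [← normalCDF_sub]; ring
  rw [h]
  refine HasStrictDerivAt.const_add _ ?_
  exact intervalIntegral.integral_hasStrictDerivAt_right
    (continuous_gaussianPDFReal_std.intervalIntegrable _ _)
    continuous_gaussianPDFReal_std.aestronglyMeasurable.stronglyMeasurableAtFilter
    continuous_gaussianPDFReal_std.continuousAt

lemma strictMono_normalCDF : StrictMono normalCDF := by
  refine strictMono_of_deriv_pos fun t => ?_
  rw [(hasStrictDerivAt_normalCDF t).hasDerivAt.deriv]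
  exact gaussianPDFReal_pos 0 1 t one_ne_zero

lemma continuous_normalCDF : Continuous normalCDF :=
  continuous_iff_continuousAt.2 fun t => (hasStrictDerivAt_normalCDF t).hasDerivAt.continuousAt

lemma normalCDF_eq_cdf : normalCDF = cdf (gaussianReal 0 1) := by
  ext t; rw [cdf_eq_real]; rfl

lemma normalCDF_pos (t : ℝ) : 0 < normalCDF t :=
  measureReal_nonneg.trans_lt (strictMono_normalCDF (sub_one_lt t))

lemma normalCDF_lt_one (t : ℝ) : normalCDF t < 1 :=
  (strictMono_normalCDF (lt_add_one t)).trans_le measureReal_le_one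

lemma exists_normalCDF_eq {p : ℝ} (h0 : 0 < p) (h1 : p < 1) : ∃ t, normalCDF t = p := by
  have hb := (tendsto_cdf_atBot (gaussianReal 0 1)).eventually_lt_const h0
  have ht := (tendsto_cdf_atTop (gaussianReal 0 1)).eventually_const_lt h1
  rw [← normalCDF_eq_cdf] at hb ht
  obtain ⟨a, ha⟩ := hb.exists
  obtain ⟨b, hb⟩ := ht.exists
  exact mem_range_of_exists_le_of_exists_ge continuous_normalCDF ⟨a, ha.le⟩ ⟨b, hb.le⟩

lemma normalCDF_neg (t : ℝ) : normalCDF (-t) = 1 - normalCDF t := by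
  have := nullSingletonClass_gaussianReal (μ := 0) (v := 1) one_ne_zero
  have h : normalCDF (-t) = (gaussianReal 0 1).real (Set.Ici t) := by
    have h2 : (gaussianReal 0 1).map (fun x => -x) = gaussianReal 0 1 := by
      rw [gaussianReal_map_neg, neg_zero]
    rw [normalCDF]
    conv_lhs => rw [← h2]
    rw [map_measureReal_apply measurable_neg measurableSet_Iic]
    congr 1
    ext x; simp
  rw [h, normalCDF, ← Set.compl_Iio, probReal_compl_eq_one_sub measurableSet_Iio,
    measureReal_def, measureReal_def, measure_congr Iio_ae_eq_Iic]

section stdGaussian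

variable {E : Type*} [NormedAddCommGroup E] [InnerProductSpace ℝ E] [FiniteDimensional ℝ E]
  [MeasurableSpace E] [BorelSpace E]

/-- The density of the standard Gaussian measure with respect to Lebesgue measure. -/
lemma stdGaussian_eq_withDensity :
    stdGaussian E = volume.withDensity fun x : E => ENNReal.ofReal
      ((2 * Real.pi) ^ (-(Module.finrank ℝ E / 2 : ℝ)) * Real.exp (-(1 / 2) * ‖x‖ ^ 2)) := by
  have hval : ∫ x : E, Real.exp (-(1 / 2) * ‖x‖ ^ 2)
      = (2 * Real.pi) ^ ((Module.finrank ℝ E / 2 : ℝ)) := by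
    rw [GaussianFourier.integral_rexp_neg_mul_sq_norm (V := E) (b := 1 / 2) (by norm_num)]
    congr 1; ring
  -- A non-integrable function would have the junk integral `0`.
  have hint : Integrable fun x : E => Real.exp (-(1 / 2) * ‖x‖ ^ 2) := by
    by_contra h
    rw [integral_undef h] at hval
    exact (Real.rpow_pos_of_pos (by positivity) _).ne hval
  have hfin : IsFiniteMeasure (volume.withDensity fun x : E => ENNReal.ofReal
      ((2 * Real.pi) ^ (-(Module.finrank ℝ E / 2 : ℝ)) * Real.exp (-(1 / 2) * ‖x‖ ^ 2))) :=
    isFiniteMeasure_withDensity_ofReal (hint.const_mul _).2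
  -- Both measures have the characteristic function `exp (-‖t‖² / 2)`.
  refine Measure.ext_of_charFun (funext fun t => ?_)
  rw [charFun_stdGaussian, charFun_apply, integral_withDensity_eq_integral_toReal_smul
    (by fun_prop) (by simp)]
  have key := GaussianFourier.integral_cexp_neg_mul_sq_norm_add (V := E) (b := 1 / 2)
    (by norm_num) Complex.I t
  have h2 : ∀ x : E, (ENNReal.ofReal ((2 * Real.pi) ^ (-(Module.finrank ℝ E / 2 : ℝ)) *
      Real.exp (-(1 / 2) * ‖x‖ ^ 2))).toReal • Complex.exp (⟪x, t⟫ * Complex.I)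
      = (((2 * Real.pi) ^ (-(Module.finrank ℝ E / 2 : ℝ)) : ℝ) : ℂ) *
        Complex.exp (-(1 / 2) * ‖x‖ ^ 2 + Complex.I * ⟪t, x⟫) := by
    intro x
    rw [ENNReal.toReal_ofReal (by positivity), Complex.real_smul, Complex.exp_add,
      real_inner_comm x t]
    push_cast
    ring_nf
  simp_rw [h2]
  rw [integral_const_mul, key]
  rw [← mul_assoc]
  have h3 : ((Real.pi : ℂ) / (1 / 2)) ^ ((Module.finrank ℝ E : ℂ) / 2)
      = (((2 * Real.pi) ^ ((Module.finrank ℝ E / 2 : ℝ)) : ℝ) : ℂ) := by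
    rw [Complex.ofReal_cpow (by positivity)]
    push_cast
    congr 1; ring
  rw [h3, ← Complex.ofReal_mul, ← Real.rpow_add (by positivity)]
  simp only [neg_add_cancel, Real.rpow_zero, Complex.ofReal_one, one_mul]
  congr 1
  rw [Complex.I_sq]; ring

lemma stdGaussian_map_inner {w : E} (hw : ‖w‖ = 1) :
    (stdGaussian E).map (fun x => ⟪w, x⟫) = gaussianReal 0 1 := by
  have h := IsGaussian.map_eq_gaussianReal (μ := stdGaussian E) (innerSL ℝ w)
  rw [variance_dual_stdGaussian, integral_strongDual_stdGaussian] at h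
  simpa [hw] using h

/-- A linear map whose adjoint is an isometry carries the standard Gaussian measure to the standard
Gaussian measure. -/
lemma stdGaussian_map_of_adjoint {F : Type*} [NormedAddCommGroup F] [InnerProductSpace ℝ F]
    [FiniteDimensional ℝ F] [MeasurableSpace F] [BorelSpace F] (A : E →L[ℝ] F) (B : F → E)
    (hAB : ∀ x y, ⟪A x, y⟫ = ⟪x, B y⟫) (hB : ∀ y, ‖B y‖ = ‖y‖) :
    (stdGaussian E).map A = stdGaussian F := by
  refine Measure.ext_of_charFun (funext fun t => ?_)
  rw [charFun_stdGaussian, ← hB, ← charFun_stdGaussian, charFun_apply, charFun_apply,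
    integral_map (by fun_prop) (by fun_prop)]
  simp_rw [hAB]

lemma stdGaussian_real_inner_le {w : E} (hw : ‖w‖ = 1) (t : ℝ) :
    (stdGaussian E).real {x | ⟪w, x⟫ ≤ t} = normalCDF t := by
  rw [normalCDF, ← stdGaussian_map_inner hw, map_measureReal_apply (by fun_prop) measurableSet_Iic]
  rfl

lemma stdGaussian_real_lt_inner {w : E} (hw : ‖w‖ = 1) (t : ℝ) :
    (stdGaussian E).real {x | t < ⟪w, x⟫} = 1 - normalCDF t := by
  rw [← stdGaussian_real_inner_le hw, ← probReal_compl_eq_one_sub]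
  · congr 1; ext x; simp
  · exact measurableSet_le (by fun_prop) (by fun_prop)

lemma stdGaussian_real_forall_inner_le {ι : Type*} [Fintype ι] (b : OrthonormalBasis ι ℝ E)
    (t : ℝ) :
    (stdGaussian E).real {x | ∀ i, ⟪b i, x⟫ ≤ t} = normalCDF t ^ Fintype.card ι := by
  classical
  rw [stdGaussian_eq_map_pi_orthonormalBasis b, map_measureReal_apply (by fun_prop)]
  · have : (fun x : ι → ℝ => ∑ i, x i • b i) ⁻¹' {x | ∀ i, ⟪b i, x⟫ ≤ t}
        = Set.univ.pi fun _ => Set.Iic t := by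
      ext x
      simp [inner_sum, inner_smul_right, b.inner_eq_ite, Pi.le_def]
    rw [this, measureReal_def, Measure.pi_pi]
    simp [normalCDF, measureReal_def]
  · simp only [Set.ofPred_forall]
    exact MeasurableSet.iInter fun i => measurableSet_le (by fun_prop) (by fun_prop)

end stdGaussian

/-! ### The Gaussian Brascamp–Lieb inequality for half-lines -/

section BrascampLieb

variable {E : Type*} [NormedAddCommGroup E] [InnerProductSpace ℝ E]
  {ι : Type*} [Fintype ι] {w : ι → E} {d : ι → ℝ}

lemma sum_mul_inner_sq_of_decomposition (hid : ∀ x, ∑ i, (d i * ⟪w i, x⟫) • w i = x) (x : E) :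
    ∑ i, d i * ⟪w i, x⟫ ^ 2 = ‖x‖ ^ 2 := by
  rw [← real_inner_self_eq_norm_sq]
  conv_rhs => enter [2]; rw [← hid x]
  rw [sum_inner]
  refine Finset.sum_congr rfl fun i _ => ?_
  rw [inner_smul_left]
  simp; ring

/-- Bessel's inequality for a decomposition of the identity. -/
lemma norm_sq_sum_smul_le_of_decomposition (hd : ∀ i, 0 ≤ d i)
    (hid : ∀ x, ∑ i, (d i * ⟪w i, x⟫) • w i = x) (a : ι → ℝ) :
    ‖∑ i, (d i * a i) • w i‖ ^ 2 ≤ ∑ i, d i * a i ^ 2 := by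
  set z := ∑ i, (d i * a i) • w i with hz
  have h1 : ∑ i, d i * a i * ⟪w i, z⟫ = ‖z‖ ^ 2 := by
    rw [← real_inner_self_eq_norm_sq]
    conv_rhs => enter [2]; rw [hz]
    rw [sum_inner]
    refine Finset.sum_congr rfl fun i _ => ?_
    rw [inner_smul_left]
    simp
  have h2 := sum_mul_inner_sq_of_decomposition hid z
  have h3 : 0 ≤ ∑ i, d i * (a i - ⟪w i, z⟫) ^ 2 :=
    Finset.sum_nonneg fun i _ => mul_nonneg (hd i) (sq_nonneg _)
  have h4 : ∑ i, d i * (a i - ⟪w i, z⟫) ^ 2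
      = ∑ i, d i * a i ^ 2 - 2 * ∑ i, d i * a i * ⟪w i, z⟫ + ∑ i, d i * ⟪w i, z⟫ ^ 2 := by
    rw [Finset.mul_sum, ← Finset.sum_sub_distrib, ← Finset.sum_add_distrib]
    exact Finset.sum_congr rfl fun i _ => by ring
  linarith

variable [FiniteDimensional ℝ E]

/-- The trace of a decomposition of the identity by unit vectors. -/
lemma sum_weights_of_decomposition (hw : ∀ i, ‖w i‖ = 1)
    (hid : ∀ x, ∑ i, (d i * ⟪w i, x⟫) • w i = x) :
    ∑ i, d i = Module.finrank ℝ E := by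
  have h : ∀ j, ∑ i, d i * ⟪w i, stdOrthonormalBasis ℝ E j⟫ ^ 2 = 1 := fun j => by
    rw [sum_mul_inner_sq_of_decomposition hid]; simp
  have h2 : ∑ j, ∑ i, d i * ⟪w i, stdOrthonormalBasis ℝ E j⟫ ^ 2 = ∑ i, d i := by
    rw [Finset.sum_comm]
    refine Finset.sum_congr rfl fun i _ => ?_
    rw [← Finset.mul_sum, (stdOrthonormalBasis ℝ E).sum_sq_inner_left, hw]; simp
  rw [← h2]; simp [h]

/-- If `∑ dᵢ wᵢ ⊗ wᵢ` is the identity, then `det (∑ dᵢ aᵢ wᵢ ⊗ wᵢ) ≥ ∏ aᵢ ^ dᵢ`: each eigenvalue is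
an average of the `aᵢ` with the weights `dᵢ ⟪wᵢ, e⟫²` of its unit eigenvector `e`, hence at least
their weighted geometric mean. -/
lemma prod_rpow_le_det (hd : ∀ i, 0 ≤ d i) (hw : ∀ i, ‖w i‖ = 1)
    (hid : ∀ x, ∑ i, (d i * ⟪w i, x⟫) • w i = x) {a : ι → ℝ} (ha : ∀ i, 0 < a i) (A : E →L[ℝ] E)
    (hA : ∀ x, A x = ∑ i, (d i * a i * ⟪w i, x⟫) • w i) :
    ∏ i, a i ^ d i ≤ A.det := by
  have hsym : (A : E →ₗ[ℝ] E).IsSymmetric := by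
    intro x y
    simp only [ContinuousLinearMap.coe_coe, hA, sum_inner, inner_sum, inner_smul_left,
      inner_smul_right]
    refine Finset.sum_congr rfl fun i _ => ?_
    rw [real_inner_comm x]; simp; ring
  have hdet := hsym.det_eq_prod_eigenvalues rfl
  rw [ContinuousLinearMap.det, hdet]
  set b := hsym.eigenvectorBasis rfl
  have heig : ∀ j, (hsym.eigenvalues rfl j : ℝ) = ∑ i, d i * ⟪w i, b j⟫ ^ 2 * a i := by
    intro j
    have h1 := hsym.apply_eigenvectorBasis rfl j
    have h2 : ⟪A (b j), b j⟫ = (hsym.eigenvalues rfl j : ℝ) := by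
      have : A (b j) = (hsym.eigenvalues rfl j : ℝ) • b j := h1
      rw [this, inner_smul_left]; simp
    rw [← h2, hA, sum_inner]
    refine Finset.sum_congr rfl fun i _ => ?_
    rw [inner_smul_left]; simp; ring
  have hle : ∀ j, ∏ i, a i ^ (d i * ⟪w i, b j⟫ ^ 2) ≤ (hsym.eigenvalues rfl j : ℝ) := by
    intro j
    rw [heig]
    refine Real.geom_mean_le_arith_mean_weighted _ _ _ (fun i _ => ?_) ?_ fun i _ => (ha i).le
    · exact mul_nonneg (hd i) (sq_nonneg _)
    · rw [sum_mul_inner_sq_of_decomposition hid]; simp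
  calc ∏ i, a i ^ d i = ∏ j, ∏ i, a i ^ (d i * ⟪w i, b j⟫ ^ 2) := by
        rw [Finset.prod_comm]
        refine Finset.prod_congr rfl fun i _ => ?_
        rw [← Real.rpow_sum_of_pos (ha i), ← Finset.mul_sum, b.sum_sq_inner_left, hw]; simp
    _ ≤ _ := by
        simp only [RCLike.ofReal_real_eq_id, id]
        exact Finset.prod_le_prod (fun j _ => Finset.prod_nonneg fun i _ =>
          Real.rpow_nonneg (ha i).le _) fun j _ => hle j

/-- The monotone map carrying the standard normal law conditioned to the half-line `(-∞, τ]` to the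
standard normal law; it is meaningful on `(-∞, τ)`. -/
noncomputable def truncatedTransport (τ s : ℝ) : ℝ :=
  Function.invFun normalCDF (normalCDF s / normalCDF τ)

lemma normalCDF_truncatedTransport {τ s : ℝ} (h : s < τ) :
    normalCDF (truncatedTransport τ s) = normalCDF s / normalCDF τ :=
  Function.invFun_eq (exists_normalCDF_eq (div_pos (normalCDF_pos s) (normalCDF_pos τ))
    ((div_lt_one (normalCDF_pos τ)).2 (strictMono_normalCDF h)))

lemma truncatedTransport_strictMonoOn (τ : ℝ) :
    StrictMonoOn (truncatedTransport τ) (Set.Iio τ) := by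
  intro s hs t ht hst
  rw [← strictMono_normalCDF.lt_iff_lt, normalCDF_truncatedTransport hs,
    normalCDF_truncatedTransport ht]
  exact div_lt_div_of_pos_right (strictMono_normalCDF hst) (normalCDF_pos τ)

/-- The derivative of the transport map, as given by the change of variables formula. -/
noncomputable def truncatedTransportDeriv (τ s : ℝ) : ℝ :=
  (gaussianPDFReal 0 1 (truncatedTransport τ s))⁻¹ * (gaussianPDFReal 0 1 s / normalCDF τ)

lemma truncatedTransportDeriv_pos (τ s : ℝ) : 0 < truncatedTransportDeriv τ s :=
  mul_pos (inv_pos.2 (gaussianPDFReal_pos 0 1 _ one_ne_zero))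
    (div_pos (gaussianPDFReal_pos 0 1 _ one_ne_zero) (normalCDF_pos τ))

lemma hasDerivAt_truncatedTransport {τ s : ℝ} (h : s < τ) :
    HasDerivAt (truncatedTransport τ) (truncatedTransportDeriv τ s) s := by
  have h1 := (hasStrictDerivAt_normalCDF (truncatedTransport τ s)).to_local_left_inverse
    (gaussianPDFReal_pos 0 1 _ one_ne_zero).ne' (g := Function.invFun normalCDF)
    (Filter.Eventually.of_forall (Function.leftInverse_invFun strictMono_normalCDF.injective))
  rw [normalCDF_truncatedTransport h] at h1
  exact h1.hasDerivAt.comp s ((hasStrictDerivAt_normalCDF s).hasDerivAt.div_const _)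

lemma truncatedTransportDeriv_mul_exp (τ s : ℝ) :
    truncatedTransportDeriv τ s * Real.exp (-(1 / 2) * truncatedTransport τ s ^ 2)
      = Real.exp (-(1 / 2) * s ^ 2) / normalCDF τ := by
  have : 0 < (√(2 * Real.pi))⁻¹ := by positivity
  have hτ := normalCDF_pos τ
  rw [truncatedTransportDeriv, gaussianPDFReal_std_eq, gaussianPDFReal_std_eq]
  field_simp

variable [MeasurableSpace E] [BorelSpace E]

/-- The Gaussian Brascamp–Lieb inequality for half-lines, in strict form: transport the restriction
of the Gaussian measure to the polyhedron by `y ↦ ∑ dᵢ Tᵢ(⟪wᵢ, y⟫) wᵢ`, where `Tᵢ` carries the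
one-dimensional conditioned Gaussian measure to the Gaussian measure. -/
lemma stdGaussian_forall_inner_lt_le (hd : ∀ i, 0 < d i) (hw : ∀ i, ‖w i‖ = 1)
    (hid : ∀ x, ∑ i, (d i * ⟪w i, x⟫) • w i = x) (τ : ι → ℝ) :
    stdGaussian E {x | ∀ i, ⟪w i, x⟫ < τ i}
      ≤ ENNReal.ofReal (∏ i, normalCDF (τ i) ^ d i) := by
  set K : Set E := {x | ∀ i, ⟪w i, x⟫ < τ i} with hK
  set P : ℝ := ∏ i, normalCDF (τ i) ^ d i with hP
  have hPpos : 0 < P := Finset.prod_pos fun i _ => Real.rpow_pos_of_pos (normalCDF_pos _) _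
  have hKm : MeasurableSet K := by
    simp only [hK, Set.ofPred_forall]
    exact MeasurableSet.iInter fun i => measurableSet_lt (by fun_prop) (by fun_prop)
  set Θ : E → E := fun y => ∑ i, (d i * truncatedTransport (τ i) ⟪w i, y⟫) • w i with hΘ
  set Θ' : E → E →L[ℝ] E := fun y =>
    ∑ i, (d i • truncatedTransportDeriv (τ i) ⟪w i, y⟫ • innerSL ℝ (w i)).smulRight (w i) with hΘ'
  have hder : ∀ y ∈ K, HasFDerivWithinAt Θ (Θ' y) K y := by
    intro y hy
    refine HasFDerivAt.hasFDerivWithinAt (HasFDerivAt.fun_sum fun i _ => ?_)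
    have h1 : HasFDerivAt (fun y => ⟪w i, y⟫) (innerSL ℝ (w i)) y :=
      (innerSL ℝ (w i)).hasFDerivAt
    exact (((hasDerivAt_truncatedTransport (hy i)).comp_hasFDerivAt y h1).const_mul
      (d i)).smul_const (w i)
  -- `Θ` is strictly monotone, being a positive combination of monotone functions of the `⟪wᵢ, ·⟫`.
  have hinj : Set.InjOn Θ K := by
    intro y hy z hz hyz
    by_contra hne
    have h0 : ⟪Θ y - Θ z, y - z⟫ = ∑ i, d i * ((truncatedTransport (τ i) ⟪w i, y⟫
        - truncatedTransport (τ i) ⟪w i, z⟫) * (⟪w i, y⟫ - ⟪w i, z⟫)) := by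
      rw [hΘ, ← Finset.sum_sub_distrib, sum_inner]
      refine Finset.sum_congr rfl fun i _ => ?_
      rw [← sub_smul, inner_smul_left, inner_sub_right]
      simp; ring
    have hterm : ∀ i, 0 ≤ d i * ((truncatedTransport (τ i) ⟪w i, y⟫
        - truncatedTransport (τ i) ⟪w i, z⟫) * (⟪w i, y⟫ - ⟪w i, z⟫)) := by
      intro i
      refine mul_nonneg (hd i).le ?_
      rcases le_total ⟪w i, y⟫ ⟪w i, z⟫ with h | h
      · exact mul_nonneg_of_nonpos_of_nonpos (sub_nonpos.2
          ((truncatedTransport_strictMonoOn _).monotoneOn (hy i) (hz i) h)) (sub_nonpos.2 h)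
      · exact mul_nonneg (sub_nonneg.2
          ((truncatedTransport_strictMonoOn _).monotoneOn (hz i) (hy i) h)) (sub_nonneg.2 h)
    rw [hyz, sub_self, inner_zero_left] at h0
    have h1 := (Finset.sum_eq_zero_iff_of_nonneg fun i _ => hterm i).1 h0.symm
    have h2 : ∀ i, ⟪w i, y - z⟫ = 0 := by
      intro i
      have h3 := h1 i (Finset.mem_univ i)
      rw [inner_sub_right, sub_eq_zero]
      rcases mul_eq_zero.1 h3 with h | h
      · exact absurd h (hd i).ne'
      · rcases mul_eq_zero.1 h with h | h
        · exact (truncatedTransport_strictMonoOn _).injOn (hy i) (hz i) (sub_eq_zero.1 h)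
        · exact sub_eq_zero.1 h
    apply hne
    rw [← sub_eq_zero, ← hid (y - z)]
    simp [h2]
  set c : ℝ := (2 * Real.pi) ^ (-(Module.finrank ℝ E / 2 : ℝ)) with hc
  have hcpos : 0 < c := Real.rpow_pos_of_pos (by positivity) _
  set ρ : E → ENNReal := fun x => ENNReal.ofReal (c * Real.exp (-(1 / 2) * ‖x‖ ^ 2)) with hρ
  have hγ : stdGaussian E = volume.withDensity ρ := stdGaussian_eq_withDensity
  -- The Jacobian is bounded below by `prod_rpow_le_det` and the density at `Θ y` by Bessel's
  -- inequality; the product of the two bounds is computed one coordinate at a time.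
  have hpt : ∀ y ∈ K, ρ y ≤ ENNReal.ofReal P * (ENNReal.ofReal |(Θ' y).det| * ρ (Θ y)) := by
    intro y hy
    rw [hρ]
    simp only
    rw [← ENNReal.ofReal_mul (abs_nonneg _), ← ENNReal.ofReal_mul hPpos.le]
    refine ENNReal.ofReal_le_ofReal ?_
    have hdet : ∏ i, truncatedTransportDeriv (τ i) ⟪w i, y⟫ ^ d i ≤ |(Θ' y).det| :=
      (prod_rpow_le_det (fun i => (hd i).le) hw hid (fun i => truncatedTransportDeriv_pos _ _) _
        fun x => by simp [hΘ', mul_assoc]).trans (le_abs_self _)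
    have hexp : ∏ i, Real.exp (-(1 / 2) * truncatedTransport (τ i) ⟪w i, y⟫ ^ 2) ^ d i
        ≤ Real.exp (-(1 / 2) * ‖Θ y‖ ^ 2) := by
      simp_rw [← Real.exp_mul]
      rw [← Real.exp_sum, Real.exp_le_exp]
      have := norm_sq_sum_smul_le_of_decomposition (fun i => (hd i).le) hid
        fun i => truncatedTransport (τ i) ⟪w i, y⟫
      have h2 : ∑ i, -(1 / 2) * truncatedTransport (τ i) ⟪w i, y⟫ ^ 2 * d i
          = -(1 / 2) * ∑ i, d i * truncatedTransport (τ i) ⟪w i, y⟫ ^ 2 := by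
        rw [Finset.mul_sum]; exact Finset.sum_congr rfl fun i _ => by ring
      rw [h2]
      linarith
    have hprod : (∏ i, truncatedTransportDeriv (τ i) ⟪w i, y⟫ ^ d i)
        * ∏ i, Real.exp (-(1 / 2) * truncatedTransport (τ i) ⟪w i, y⟫ ^ 2) ^ d i
        = Real.exp (-(1 / 2) * ‖y‖ ^ 2) / P := by
      rw [← Finset.prod_mul_distrib, hP, ← sum_mul_inner_sq_of_decomposition hid y, Finset.mul_sum,
        Real.exp_sum, ← Finset.prod_div_distrib]
      refine Finset.prod_congr rfl fun i _ => ?_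
      rw [← Real.mul_rpow (truncatedTransportDeriv_pos _ _).le (Real.exp_pos _).le,
        truncatedTransportDeriv_mul_exp, Real.div_rpow (Real.exp_pos _).le (normalCDF_pos _).le,
        ← Real.exp_mul]
      ring_nf
    have h5 : Real.exp (-(1 / 2) * ‖y‖ ^ 2) / P
        ≤ |(Θ' y).det| * Real.exp (-(1 / 2) * ‖Θ y‖ ^ 2) := by
      rw [← hprod]
      refine mul_le_mul hdet hexp (Finset.prod_nonneg fun i _ =>
        Real.rpow_nonneg (Real.exp_pos _).le _) (abs_nonneg _)
    rw [div_le_iff₀ hPpos] at h5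
    calc c * Real.exp (-(1 / 2) * ‖y‖ ^ 2)
        ≤ c * (|(Θ' y).det| * Real.exp (-(1 / 2) * ‖Θ y‖ ^ 2) * P) := by gcongr
      _ = _ := by ring
  calc stdGaussian E K = ∫⁻ y in K, ρ y := by rw [hγ, withDensity_apply _ hKm]
    _ ≤ ∫⁻ y in K, ENNReal.ofReal P * (ENNReal.ofReal |(Θ' y).det| * ρ (Θ y)) :=
        setLIntegral_mono' hKm hpt
    _ = ENNReal.ofReal P * ∫⁻ y in K, ENNReal.ofReal |(Θ' y).det| * ρ (Θ y) :=
        lintegral_const_mul' _ _ ENNReal.ofReal_ne_top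
    _ = ENNReal.ofReal P * ∫⁻ y in Θ '' K, ρ y := by
        rw [lintegral_image_eq_lintegral_abs_det_fderiv_mul volume hKm hder hinj]
    _ ≤ ENNReal.ofReal P * ∫⁻ y, ρ y := by gcongr; exact Measure.restrict_le_self
    _ = ENNReal.ofReal P := by
        have : ∫⁻ y, ρ y = 1 := by
          rw [← setLIntegral_univ, ← withDensity_apply _ MeasurableSet.univ, ← hγ, measure_univ]
        rw [this, mul_one]

/-- The Gaussian Brascamp–Lieb inequality for half-lines: if `∑ dᵢ wᵢ ⊗ wᵢ` is the identity, then
`P(⟪wᵢ, Y⟫ ≤ τᵢ for all i) ≤ ∏ Φ(τᵢ) ^ dᵢ`. -/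
theorem stdGaussian_real_forall_inner_le_prod (hd : ∀ i, 0 < d i) (hw : ∀ i, ‖w i‖ = 1)
    (hid : ∀ x, ∑ i, (d i * ⟪w i, x⟫) • w i = x) (τ : ι → ℝ) :
    (stdGaussian E).real {x | ∀ i, ⟪w i, x⟫ ≤ τ i} ≤ ∏ i, normalCDF (τ i) ^ d i := by
  -- The closed half-spaces lie in open ones with thresholds `τ i + ε`; let `ε` decrease to `0`.
  have hcont : Continuous fun ε : ℝ => ∏ i, normalCDF (τ i + ε) ^ d i :=
    continuous_finsetProd _ fun i _ =>
      (continuous_normalCDF.comp (continuous_const.add continuous_id)).rpow_const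
        fun _ => Or.inr (hd i).le
  have hlim := (hcont.tendsto 0).mono_left (nhdsWithin_le_nhds (s := Set.Ioi 0))
  simp only [add_zero] at hlim
  refine ge_of_tendsto hlim (eventually_mem_nhdsWithin.mono fun ε hε => ?_)
  rw [measureReal_def]
  refine ENNReal.toReal_le_of_le_ofReal (Finset.prod_nonneg fun i _ =>
    Real.rpow_nonneg (normalCDF_pos _).le _) ?_
  refine (measure_mono fun x hx i => ?_).trans
    (stdGaussian_forall_inner_lt_le hd hw hid fun i => τ i + ε)
  exact (hx i).trans_lt (lt_add_of_pos_right _ hε)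

end BrascampLieb

/-! ### Means of maxima of Gaussian variables -/

section Expectation

variable {Ω : Type*} [MeasurableSpace Ω] {P : Measure Ω} [IsProbabilityMeasure P] {X : Ω → ℝ}

lemma integrableOn_measureReal_lt (hX : Integrable X P) (h0 : 0 ≤ X) :
    IntegrableOn (fun t => P.real {a | t < X a}) (Set.Ioi 0) := by
  have hanti : Antitone fun t => P.real {a | t < X a} := fun s t hst =>
    measureReal_mono fun a (ha : t < X a) => hst.trans_lt ha
  refine ⟨hanti.measurable.aestronglyMeasurable, ?_⟩
  rw [hasFiniteIntegral_iff_enorm]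
  have h1 := lintegral_eq_lintegral_meas_lt P (Filter.Eventually.of_forall h0) hX.aemeasurable
  have h2 : ∫⁻ a, ENNReal.ofReal (X a) ∂P < ⊤ :=
    (hasFiniteIntegral_iff_ofReal (Filter.Eventually.of_forall h0)).1 hX.2
  refine lt_of_eq_of_lt ?_ h2
  rw [h1]
  refine lintegral_congr fun t => ?_
  rw [Real.enorm_of_nonneg measureReal_nonneg, ofReal_measureReal]

lemma integrableOn_measureReal_le (hX : Integrable X P) (h0 : 0 ≤ X) :
    IntegrableOn (fun t => P.real {a | t ≤ X a}) (Set.Ioi 0) := by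
  have hanti : Antitone fun t => P.real {a | t ≤ X a} := fun s t hst =>
    measureReal_mono fun a (ha : t ≤ X a) => hst.trans ha
  refine ⟨hanti.measurable.aestronglyMeasurable, ?_⟩
  rw [hasFiniteIntegral_iff_enorm]
  have h1 := lintegral_eq_lintegral_meas_le P (Filter.Eventually.of_forall h0) hX.aemeasurable
  have h2 : ∫⁻ a, ENNReal.ofReal (X a) ∂P < ⊤ :=
    (hasFiniteIntegral_iff_ofReal (Filter.Eventually.of_forall h0)).1 hX.2
  refine lt_of_eq_of_lt ?_ h2
  rw [h1]
  refine lintegral_congr fun t => ?_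
  rw [Real.enorm_of_nonneg measureReal_nonneg, ofReal_measureReal]

/-- The layer cake formula for a random variable of either sign, in terms of its distribution
function. -/
lemma integral_eq_integral_distribution (hX : Integrable X P) (hm : Measurable X) :
    IntegrableOn (fun t => 1 - P.real {a | X a ≤ t} - P.real {a | X a ≤ -t}) (Set.Ioi 0) ∧
    ∫ a, X a ∂P = ∫ t in Set.Ioi 0, (1 - P.real {a | X a ≤ t} - P.real {a | X a ≤ -t}) := by
  have hp : Integrable (fun a => max (X a) 0) P := hX.pos_part
  have hn : Integrable (fun a => max (-X a) 0) P := hX.neg_part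
  have hp0 : 0 ≤ fun a => max (X a) 0 := fun a => le_max_right _ _
  have hn0 : 0 ≤ fun a => max (-X a) 0 := fun a => le_max_right _ _
  have e1 : ∀ t ∈ Set.Ioi (0 : ℝ), P.real {a | t < max (X a) 0} = 1 - P.real {a | X a ≤ t} := by
    intro t ht
    rw [← probReal_compl_eq_one_sub (measurableSet_le hm measurable_const)]
    congr 1; ext a
    simp [not_lt.2 (le_of_lt (Set.mem_Ioi.1 ht))]
  have e2 : ∀ t ∈ Set.Ioi (0 : ℝ), P.real {a | t ≤ max (-X a) 0} = P.real {a | X a ≤ -t} := by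
    intro t ht
    congr 1; ext a
    simp [not_le.2 (Set.mem_Ioi.1 ht), le_neg]
  have i1 := (integrableOn_measureReal_lt hp hp0).congr_fun e1 measurableSet_Ioi
  have i2 := (integrableOn_measureReal_le hn hn0).congr_fun e2 measurableSet_Ioi
  refine ⟨i1.sub i2, ?_⟩
  rw [integral_sub i1 i2, ← setIntegral_congr_fun measurableSet_Ioi e1,
    ← setIntegral_congr_fun measurableSet_Ioi e2,
    ← hp.integral_eq_integral_meas_lt (Filter.Eventually.of_forall hp0),
    ← hn.integral_eq_integral_meas_le (Filter.Eventually.of_forall hn0), ← integral_sub hp hn]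
  refine integral_congr_ae (Filter.Eventually.of_forall fun a => ?_)
  simp only
  rcases le_total (X a) 0 with h | h
  · rw [max_eq_right h, max_eq_left (by linarith)]; ring
  · rw [max_eq_left h, max_eq_right (by linarith)]; ring

end Expectation

/-- The expectation of the maximum of `N` independent standard normal variables, written through
its distribution function `Φ ^ N`. -/
noncomputable def gaussianMaxMean (N : ℕ) : ℝ :=
  ∫ t in Set.Ioi (0 : ℝ), (1 - normalCDF t ^ N - normalCDF (-t) ^ N)

section MaxInner

variable {E : Type*} [NormedAddCommGroup E] [InnerProductSpace ℝ E]
  {ι : Type*} [Fintype ι] [Nonempty ι]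

/-- The support function `y ↦ max ⟪wᵢ, y⟫` of a finite family of vectors. -/
noncomputable def maxInner (w : ι → E) (y : E) : ℝ :=
  Finset.univ.sup' Finset.univ_nonempty fun i => ⟪w i, y⟫

lemma maxInner_le_iff {w : ι → E} {y : E} {t : ℝ} : maxInner w y ≤ t ↔ ∀ i, ⟪w i, y⟫ ≤ t := by
  simp [maxInner]

lemma inner_le_maxInner (w : ι → E) (y : E) (i : ι) : ⟪w i, y⟫ ≤ maxInner w y :=
  maxInner_le_iff.1 le_rfl i

lemma exists_maxInner_eq (w : ι → E) (y : E) : ∃ i, maxInner w y = ⟪w i, y⟫ := by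
  obtain ⟨i, -, h⟩ := Finset.exists_mem_eq_sup' Finset.univ_nonempty fun i => ⟪w i, y⟫
  exact ⟨i, h⟩

lemma maxInner_const_smul (w : ι → E) {c : ℝ} (hc : 0 ≤ c) (y : E) :
    maxInner (fun i => c • w i) y = c * maxInner w y := by
  refine le_antisymm (maxInner_le_iff.2 fun i => ?_) ?_
  · rw [real_inner_smul_left]
    exact mul_le_mul_of_nonneg_left (inner_le_maxInner w y i) hc
  · obtain ⟨i, hi⟩ := exists_maxInner_eq w y
    rw [hi, ← real_inner_smul_left]
    exact inner_le_maxInner (fun i => c • w i) y i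

lemma continuous_maxInner (w : ι → E) : Continuous (maxInner w) := by
  unfold maxInner
  exact Continuous.finset_sup'_apply _ fun i _ => by fun_prop

variable [MeasurableSpace E] [BorelSpace E] [FiniteDimensional ℝ E]

lemma integrable_maxInner (w : ι → E) : Integrable (maxInner w) (stdGaussian E) := by
  have hi : Integrable (fun y : E => ‖y‖) (stdGaussian E) :=
    (IsGaussian.integrable_id (μ := stdGaussian E)).norm
  refine (hi.const_mul (∑ i, ‖w i‖)).mono' (continuous_maxInner w).aestronglyMeasurable
    (Filter.Eventually.of_forall fun y => ?_)
  obtain ⟨i, hi⟩ := exists_maxInner_eq w y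
  rw [hi]
  refine (norm_inner_le_norm _ _).trans ?_
  gcongr
  exact Finset.single_le_sum (fun j _ => norm_nonneg (w j)) (Finset.mem_univ i)

/-- The maximum over an orthonormal basis. -/
lemma integral_maxInner_orthonormalBasis (b : OrthonormalBasis ι ℝ E) :
    IntegrableOn (fun t => 1 - normalCDF t ^ Fintype.card ι - normalCDF (-t) ^ Fintype.card ι)
      (Set.Ioi 0) ∧
    ∫ y, maxInner b y ∂(stdGaussian E) = gaussianMaxMean (Fintype.card ι) := by
  have h := integral_eq_integral_distribution (integrable_maxInner (b : ι → E))
    (continuous_maxInner (b : ι → E)).measurable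
  simpa only [maxInner_le_iff, stdGaussian_real_forall_inner_le b, gaussianMaxMean] using h

lemma integrableOn_gaussianMax {N : ℕ} (hN : 0 < N) :
    IntegrableOn (fun t => 1 - normalCDF t ^ N - normalCDF (-t) ^ N) (Set.Ioi 0) := by
  have : Nonempty (Fin N) := ⟨⟨0, hN⟩⟩
  have h := (integral_maxInner_orthonormalBasis (EuclideanSpace.basisFun (Fin N) ℝ)).1
  simpa using h

lemma integral_gaussianMax_scale {N : ℕ} (hN : 0 < N) {s : ℝ} (hs : 0 < s) :
    IntegrableOn (fun t => 1 - normalCDF (t / s) ^ N - normalCDF (-t / s) ^ N) (Set.Ioi 0) ∧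
    ∫ t in Set.Ioi (0 : ℝ), (1 - normalCDF (t / s) ^ N - normalCDF (-t / s) ^ N)
      = s * gaussianMaxMean N := by
  set g : ℝ → ℝ := fun t => 1 - normalCDF t ^ N - normalCDF (-t) ^ N with hg
  have he : (fun t : ℝ => 1 - normalCDF (t / s) ^ N - normalCDF (-t / s) ^ N)
      = fun t => g (s⁻¹ * t) := by
    ext t; simp only [hg]; ring_nf
  have he' : ∀ t : ℝ, 1 - normalCDF (t / s) ^ N - normalCDF (-t / s) ^ N = g (s⁻¹ * t) :=
    fun t => congrFun he t
  constructor
  · rw [he, integrableOn_Ioi_comp_mul_left_iff g 0 (inv_pos.2 hs), mul_zero]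
    exact integrableOn_gaussianMax hN
  · simp_rw [he']
    rw [integral_comp_mul_left_Ioi g 0 (inv_pos.2 hs), mul_zero, inv_inv, smul_eq_mul,
      gaussianMaxMean]

variable {w : ι → E} {d : ι → ℝ}

/-- The distribution function of a maximum of Gaussian variables `σᵢ ⟪wᵢ, ·⟫` lies below a mixture
of distribution functions of maxima of independent variables of equal variances: this combines the
Brascamp–Lieb inequality with the inequality of weighted means. -/
lemma distribution_maxInner_le (hd : ∀ i, 0 < d i) (hw : ∀ i, ‖w i‖ = 1)
    (hid : ∀ x, ∑ i, (d i * ⟪w i, x⟫) • w i = x) {N : ℕ} (hN : Module.finrank ℝ E = N)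
    (hN0 : 0 < N) {σ : ι → ℝ} (hσ : ∀ i, 0 < σ i) (t : ℝ) :
    (stdGaussian E).real {y | maxInner (fun i => σ i • w i) y ≤ t}
      ≤ ∑ i, d i / N * normalCDF (t / σ i) ^ N := by
  have hN' : (0 : ℝ) < N := Nat.cast_pos.2 hN0
  have h1 : {y : E | maxInner (fun i => σ i • w i) y ≤ t} = {y | ∀ i, ⟪w i, y⟫ ≤ t / σ i} := by
    ext y
    simp only [Set.mem_ofPred_eq, maxInner_le_iff, real_inner_smul_left]
    exact forall_congr' fun i => by rw [le_div_iff₀ (hσ i), mul_comm]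
  rw [h1]
  refine (stdGaussian_real_forall_inner_le_prod hd hw hid _).trans ?_
  have hsum : ∑ i, d i / N = 1 := by
    rw [← Finset.sum_div, sum_weights_of_decomposition hw hid, hN, div_self hN'.ne']
  refine le_trans (le_of_eq (Finset.prod_congr rfl fun i _ => ?_))
    (Real.geom_mean_le_arith_mean_weighted Finset.univ (fun i => d i / N)
      (fun i => normalCDF (t / σ i) ^ N) (fun i _ => div_nonneg (hd i).le hN'.le) hsum
      fun i _ => pow_nonneg (normalCDF_pos _).le N)
  rw [← Real.rpow_natCast, ← Real.rpow_mul (normalCDF_pos _).le]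
  congr 1
  field_simp

/-- The expectation of the maximum of the Gaussian variables `σᵢ ⟪wᵢ, ·⟫` is at least that of
independent variables with the averaged deviation. -/
lemma le_integral_maxInner (hd : ∀ i, 0 < d i) (hw : ∀ i, ‖w i‖ = 1)
    (hid : ∀ x, ∑ i, (d i * ⟪w i, x⟫) • w i = x) {N : ℕ} (hN : Module.finrank ℝ E = N)
    (hN0 : 0 < N) {σ : ι → ℝ} (hσ : ∀ i, 0 < σ i) :
    (∑ i, d i / N * σ i) * gaussianMaxMean N
      ≤ ∫ y, maxInner (fun i => σ i • w i) y ∂(stdGaussian E) := by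
  have hN' : (0 : ℝ) < N := Nat.cast_pos.2 hN0
  obtain ⟨h1, h2⟩ := integral_eq_integral_distribution
    (integrable_maxInner fun i => σ i • w i) (continuous_maxInner fun i => σ i • w i).measurable
  have hsum : ∑ i, d i / N = 1 := by
    rw [← Finset.sum_div, sum_weights_of_decomposition hw hid, hN, div_self hN'.ne']
  have hint : ∀ i, IntegrableOn (fun t => d i / N *
      (1 - normalCDF (t / σ i) ^ N - normalCDF (-t / σ i) ^ N)) (Set.Ioi 0) := fun i =>
    (integral_gaussianMax_scale hN0 (hσ i)).1.const_mul _
  have h3 : (∑ i, d i / N * σ i) * gaussianMaxMean N = ∫ t in Set.Ioi (0 : ℝ),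
      ∑ i, d i / N * (1 - normalCDF (t / σ i) ^ N - normalCDF (-t / σ i) ^ N) := by
    rw [integral_finsetSum _ fun i _ => hint i, Finset.sum_mul]
    refine Finset.sum_congr rfl fun i _ => ?_
    rw [integral_const_mul, (integral_gaussianMax_scale hN0 (hσ i)).2, mul_assoc]
  rw [h2, h3]
  refine setIntegral_mono (integrable_finsetSum _ fun i _ => hint i) h1 fun t => ?_
  simp only
  have h4 : ∑ i, d i / N * (1 - normalCDF (t / σ i) ^ N - normalCDF (-t / σ i) ^ N)
      = 1 - ∑ i, d i / N * normalCDF (t / σ i) ^ N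
        - ∑ i, d i / N * normalCDF (-t / σ i) ^ N := by
    simp_rw [mul_sub, mul_one, Finset.sum_sub_distrib, hsum]
  rw [h4]
  exact sub_le_sub (sub_le_sub_left (distribution_maxInner_le hd hw hid hN hN0 hσ t) _)
    (distribution_maxInner_le hd hw hid hN hN0 hσ (-t))

/-- If the maximum of the Gaussian variables `⟪wᵢ, ·⟫` has the same expectation as in the
independent case, then the distribution functions agree almost everywhere on `(0, ∞)`, in
particular at arbitrarily large arguments. -/
lemma frequently_distribution_eq (hd : ∀ i, 0 < d i) (hw : ∀ i, ‖w i‖ = 1)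
    (hid : ∀ x, ∑ i, (d i * ⟪w i, x⟫) • w i = x) {N : ℕ} (hN : Module.finrank ℝ E = N)
    (hN0 : 0 < N) (heq : ∫ y, maxInner w y ∂(stdGaussian E) = gaussianMaxMean N) :
    ∃ᶠ t in Filter.atTop, (stdGaussian E).real {y | ∀ i, ⟪w i, y⟫ ≤ t} = normalCDF t ^ N := by
  have hN' : (0 : ℝ) < N := Nat.cast_pos.2 hN0
  have hsum : ∑ i, d i / N = 1 := by
    rw [← Finset.sum_div, sum_weights_of_decomposition hw hid, hN, div_self hN'.ne']
  have hle : ∀ t, (stdGaussian E).real {y | maxInner w y ≤ t} ≤ normalCDF t ^ N := by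
    intro t
    have := distribution_maxInner_le hd hw hid hN hN0 (σ := fun _ => 1) (fun _ => one_pos) t
    simpa [← Finset.sum_mul, hsum] using this
  obtain ⟨h1, h2⟩ := integral_eq_integral_distribution
    (integrable_maxInner w) (continuous_maxInner w).measurable
  have h3 := integrableOn_gaussianMax hN0
  have h4 : ∫ t in Set.Ioi (0 : ℝ), ((1 - (stdGaussian E).real {y | maxInner w y ≤ t}
      - (stdGaussian E).real {y | maxInner w y ≤ -t})
      - (1 - normalCDF t ^ N - normalCDF (-t) ^ N)) = 0 := by
    rw [integral_sub h1 h3, ← h2, heq, gaussianMaxMean, sub_self]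
  have h5 : Integrable (fun t => (1 - (stdGaussian E).real {y | maxInner w y ≤ t}
      - (stdGaussian E).real {y | maxInner w y ≤ -t})
      - (1 - normalCDF t ^ N - normalCDF (-t) ^ N)) (volume.restrict (Set.Ioi 0)) := h1.sub h3
  rw [integral_eq_zero_iff_of_nonneg (fun t => ?_) h5] at h4
  · rw [Filter.EventuallyEq, ae_restrict_iff' measurableSet_Ioi] at h4
    rw [Filter.frequently_atTop]
    intro a
    by_contra! hcon
    have hsub : Set.Ioi (max a 0) ⊆ {t : ℝ | ¬ (t ∈ Set.Ioi (0 : ℝ) →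
        (1 - (stdGaussian E).real {y | maxInner w y ≤ t}
      - (stdGaussian E).real {y | maxInner w y ≤ -t})
      - (1 - normalCDF t ^ N - normalCDF (-t) ^ N) = (0 : ℝ → ℝ) t)} := by
      intro t ht himp
      have ht' := max_lt_iff.1 (Set.mem_Ioi.1 ht)
      have h5 := himp ht'.2
      have h6 := hcon t ht'.1.le
      have h7 := hle t
      have h8 := hle (-t)
      simp only [Pi.zero_apply] at h5
      simp only [maxInner_le_iff] at h5 h7 h8
      exact h6 (by linarith)
    have h9 := measure_mono_null hsub (ae_iff.1 h4)
    simp at h9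
  · have h7 := hle t
    have h8 := hle (-t)
    simp only [Pi.zero_apply]
    linarith

end MaxInner

/-! ### Gaussian tails and orthogonality -/

lemma normalCDF_tail_le {t : ℝ} (ht : 0 ≤ t) :
    1 - normalCDF t ≤ Real.exp (-(1 / 2) * t ^ 2) := by
  have h := measure_ge_le_exp_mul_mgf (μ := gaussianReal 0 1) (X := id) t ht
    (integrable_exp_mul_gaussianReal t)
  rw [mgf_id_gaussianReal, ← Real.exp_add] at h
  have h2 : 1 - normalCDF t ≤ (gaussianReal 0 1).real {x | t ≤ id x} := by
    rw [normalCDF, ← probReal_compl_eq_one_sub measurableSet_Iic]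
    exact measureReal_mono fun x hx => (lt_of_not_ge hx : t < x).le
  refine (h2.trans h).trans (le_of_eq ?_)
  congr 1; simp; ring

lemma le_normalCDF_tail {t : ℝ} (ht : 0 ≤ t) :
    (√(2 * Real.pi))⁻¹ * Real.exp (-(1 / 2) * (t + 1) ^ 2) ≤ 1 - normalCDF t := by
  have h := normalCDF_sub t (t + 1)
  have h2 : ∫ x in t..(t + 1), (√(2 * Real.pi))⁻¹ * Real.exp (-(1 / 2) * (t + 1) ^ 2)
      ≤ ∫ x in t..(t + 1), gaussianPDFReal 0 1 x := by
    refine intervalIntegral.integral_mono_on (by linarith) (by simp)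
      (continuous_gaussianPDFReal_std.intervalIntegrable _ _) fun x hx => ?_
    rw [gaussianPDFReal_std_eq]
    have : x ^ 2 ≤ (t + 1) ^ 2 := pow_le_pow_left₀ (ht.trans hx.1) hx.2 2
    gcongr ?_ * Real.exp ?_
    linarith
  rw [intervalIntegral.integral_const, ← h] at h2
  simp only [add_sub_cancel_left, one_smul] at h2
  linarith [normalCDF_lt_one (t + 1)]

/-- The Gaussian tail at a larger multiple of the argument is negligible. -/
lemma tendsto_normalCDF_tail_ratio {c : ℝ} (hc : 1 < c) :
    Filter.Tendsto (fun t => (1 - normalCDF (c * t)) / (1 - normalCDF t)) Filter.atTop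
      (nhds 0) := by
  have hc0 : 0 < c := by linarith
  set K := √(2 * Real.pi) with hK
  have hKpos : 0 < K := by positivity
  have hlim : Filter.Tendsto (fun t : ℝ => K * Real.exp (t * ((1 - c ^ 2) / 2 * t + 1) + 1 / 2))
      Filter.atTop (nhds 0) := by
    rw [← mul_zero K]
    refine Filter.Tendsto.const_mul _ (Real.tendsto_exp_atBot.comp ?_)
    refine Filter.tendsto_atBot_add_const_right _ _ ?_
    refine Filter.Tendsto.atTop_mul_atBot₀ Filter.tendsto_id ?_
    refine Filter.tendsto_atBot_add_const_right _ _ ?_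
    exact Filter.tendsto_id.const_mul_atTop_of_neg (by nlinarith)
  refine squeeze_zero' (Filter.Eventually.of_forall fun t => ?_) ?_ hlim
  · exact div_nonneg (sub_nonneg.2 (normalCDF_lt_one _).le) (sub_nonneg.2 (normalCDF_lt_one _).le)
  · filter_upwards [Filter.eventually_ge_atTop 0] with t ht
    rw [div_le_iff₀ (sub_pos.2 (normalCDF_lt_one _))]
    refine (normalCDF_tail_le (mul_nonneg hc0.le ht)).trans ?_
    refine le_trans (le_of_eq ?_) (mul_le_mul_of_nonneg_left (le_normalCDF_tail ht)
      (mul_pos hKpos (Real.exp_pos _)).le)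
    rw [mul_mul_mul_comm, mul_inv_cancel₀ hKpos.ne', one_mul, ← Real.exp_add]
    congr 1; ring

/-- A decomposition of the identity by at most `dim E` unit vectors is orthogonal. -/
lemma orthonormal_of_decomposition_of_card_le {E : Type*} [NormedAddCommGroup E]
    [InnerProductSpace ℝ E] {ι : Type*} [Fintype ι] {w : ι → E} {d : ι → ℝ} (hd : ∀ i, 0 < d i)
    (hw : ∀ i, ‖w i‖ = 1) (hid : ∀ x, ∑ i, (d i * ⟪w i, x⟫) • w i = x)
    (hcard : Fintype.card ι ≤ Module.finrank ℝ E) :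
    Orthonormal ℝ w ∧ Fintype.card ι = Module.finrank ℝ E := by
  classical
  have hspan : ⊤ ≤ Submodule.span ℝ (Set.range w) := fun x _ => by
    rw [← hid x]
    exact Submodule.sum_mem _ fun i _ => Submodule.smul_mem _ _ (Submodule.subset_span ⟨i, rfl⟩)
  have hcard' : Fintype.card ι = Module.finrank ℝ E := by
    refine le_antisymm hcard ?_
    have := finrank_range_le_card (R := ℝ) w
    rwa [Set.finrank, top_le_iff.1 hspan, finrank_top] at this
  have hli := linearIndependent_of_top_le_span_of_card_eq_finrank hspan hcard'
  refine ⟨⟨hw, fun i j hij => ?_⟩, hcard'⟩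
  have h1 : ∑ l, (d l * ⟪w l, w j⟫ - if l = j then 1 else 0) • w l = 0 := by
    simp_rw [sub_smul, Finset.sum_sub_distrib, hid]
    simp
  have h2 := Fintype.linearIndependent_iff.1 hli _ h1 i
  rw [if_neg hij, sub_zero] at h2
  exact (mul_eq_zero.1 h2).resolve_left (hd i).ne'

section Tail

variable {E : Type*} [NormedAddCommGroup E] [InnerProductSpace ℝ E]
  [MeasurableSpace E] [BorelSpace E] [FiniteDimensional ℝ E]

/-- Two distinct unit vectors have negligible joint Gaussian tail, since their mean is shorter
than a unit vector. -/
lemma tendsto_joint_tail_ratio {v w : E} (hv : ‖v‖ = 1) (hw : ‖w‖ = 1) (hne : v ≠ w) :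
    Filter.Tendsto (fun t => (stdGaussian E).real {y | t < ⟪v, y⟫ ∧ t < ⟪w, y⟫}
      / (1 - normalCDF t)) Filter.atTop (nhds 0) := by
  set m : E := (1 / 2 : ℝ) • (v + w) with hm
  have hm1 : ‖m‖ < 1 := by
    -- By the parallelogram law, as `v ≠ w`.
    have h := parallelogram_law_with_norm ℝ v w
    have h2 : 0 < ‖v - w‖ := norm_pos_iff.2 (sub_ne_zero.2 hne)
    rw [hm, norm_smul, Real.norm_of_nonneg (by norm_num)]
    rw [hv, hw] at h
    nlinarith [norm_nonneg (v + w)]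
  have hmean : ∀ t y, t < ⟪v, y⟫ → t < ⟪w, y⟫ → t < ⟪m, y⟫ := by
    intro t y h1 h2
    rw [hm, real_inner_smul_left, inner_add_left]; linarith
  by_cases h0 : m = 0
  · refine tendsto_const_nhds.congr' ?_
    filter_upwards [Filter.eventually_ge_atTop 0] with t ht
    have : {y : E | t < ⟪v, y⟫ ∧ t < ⟪w, y⟫} = ∅ := by
      ext y
      simp only [Set.mem_ofPred_eq, Set.mem_empty_iff_false, iff_false]
      rintro ⟨h1, h2⟩
      have := hmean t y h1 h2
      rw [h0, inner_zero_left] at this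
      linarith
    rw [this]; simp
  · have hmpos : 0 < ‖m‖ := norm_pos_iff.2 h0
    refine squeeze_zero (fun t => ?_) (fun t => ?_)
      (tendsto_normalCDF_tail_ratio (one_lt_inv_iff₀.2 ⟨hmpos, hm1⟩))
    · exact div_nonneg measureReal_nonneg (sub_nonneg.2 (normalCDF_lt_one _).le)
    · refine div_le_div_of_nonneg_right ?_ (sub_nonneg.2 (normalCDF_lt_one _).le)
      have hu : ‖‖m‖⁻¹ • m‖ = 1 := by
        rw [norm_smul, norm_inv, norm_norm, inv_mul_cancel₀ hmpos.ne']
      rw [← stdGaussian_real_lt_inner hu]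
      refine measureReal_mono fun y hy => ?_
      simp only [Set.mem_ofPred_eq, real_inner_smul_left]
      exact mul_lt_mul_of_pos_left (hmean t y hy.1 hy.2) (inv_pos.2 hmpos)

variable {ι : Type*} [Fintype ι] {w : ι → E}

/-- Bonferroni's inequality for the tail of a maximum. -/
lemma le_stdGaussian_exists_lt_inner [DecidableEq ι] (hw : ∀ i, ‖w i‖ = 1) (t : ℝ) :
    ∑ i, (1 - normalCDF t - ∑ j ∈ Finset.univ.erase i,
        (stdGaussian E).real {y | t < ⟪w i, y⟫ ∧ t < ⟪w j, y⟫})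
      ≤ (stdGaussian E).real {y | ∃ i, t < ⟪w i, y⟫} := by
  have hA : ∀ i, MeasurableSet {y : E | t < ⟪w i, y⟫} := fun i =>
    measurableSet_lt (by fun_prop) (by fun_prop)
  -- `B i` is the event that `⟪w i, ·⟫` is the only variable exceeding `t`.
  set B : ι → Set E := fun i =>
    {y | t < ⟪w i, y⟫} \ ⋃ j ∈ Finset.univ.erase i, {y | t < ⟪w i, y⟫ ∧ t < ⟪w j, y⟫} with hB
  have hBm : ∀ i, MeasurableSet (B i) := fun i => (hA i).diff
    (Finset.measurableSet_biUnion _ fun j _ => (hA i).inter (hA j))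
  have hdisj : Pairwise (Function.onFun Disjoint B) := by
    intro i j hij
    rw [Function.onFun, Set.disjoint_left]
    rintro y ⟨hy, hy'⟩ ⟨hz, -⟩
    refine hy' ?_
    simp only [Set.mem_iUnion]
    exact ⟨j, by simp [hij.symm], hy, hz⟩
  calc _ ≤ ∑ i, (stdGaussian E).real (B i) := by
        refine Finset.sum_le_sum fun i _ => ?_
        rw [← stdGaussian_real_lt_inner (hw i)]
        refine (sub_le_sub_left (measureReal_biUnion_finset_le _ _) _).trans ?_
        exact le_measureReal_sdiff (h := measure_ne_top _ _)
    _ = (stdGaussian E).real (⋃ i, B i) := by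
        rw [measureReal_iUnion_fintype hdisj hBm]
    _ ≤ _ := measureReal_mono fun y hy => by
        obtain ⟨i, hi⟩ := Set.mem_iUnion.1 hy
        exact ⟨i, hi.1⟩

/-- If the maximum of the Gaussian variables `⟪wᵢ, ·⟫`, for distinct unit vectors `wᵢ`, is
distributed at large arguments like the maximum of `N` independent ones, then there are at most `N`
vectors: the tail of the former is asymptotically the number of vectors times the one-dimensional
tail. -/
lemma card_le_of_frequently_distribution_eq (hw : ∀ i, ‖w i‖ = 1) (hinj : Function.Injective w)
    {N : ℕ} (hfreq : ∃ᶠ t in Filter.atTop,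
      (stdGaussian E).real {y | ∀ i, ⟪w i, y⟫ ≤ t} = normalCDF t ^ N) :
    Fintype.card ι ≤ N := by
  classical
  by_contra! hlt
  have hlim : Filter.Tendsto (fun t => ∑ i, ∑ j ∈ Finset.univ.erase i,
      (stdGaussian E).real {y | t < ⟪w i, y⟫ ∧ t < ⟪w j, y⟫} / (1 - normalCDF t))
      Filter.atTop (nhds 0) := by
    have : (0 : ℝ) = ∑ i : ι, ∑ j ∈ Finset.univ.erase i, 0 := by simp
    rw [this]
    refine tendsto_finsetSum _ fun i _ => tendsto_finsetSum _ fun j hj => ?_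
    exact tendsto_joint_tail_ratio (hw i) (hw j) fun h => Finset.ne_of_mem_erase hj (hinj h).symm
  obtain ⟨t, ht, hsmall⟩ := (hfreq.and_eventually (hlim.eventually_lt_const one_pos)).exists
  have hQ : 0 < 1 - normalCDF t := sub_pos.2 (normalCDF_lt_one t)
  have h1 := le_stdGaussian_exists_lt_inner hw t
  have h2 : (stdGaussian E).real {y | ∃ i, t < ⟪w i, y⟫} = 1 - normalCDF t ^ N := by
    rw [← ht, ← probReal_compl_eq_one_sub]
    · congr 1; ext y; simp
    · simp only [Set.ofPred_forall]
      exact MeasurableSet.iInter fun i => measurableSet_le (by fun_prop) (by fun_prop)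
  -- Bernoulli's inequality bounds the tail of the maximum of `N` independent variables.
  have h3 : 1 - normalCDF t ^ N ≤ N * (1 - normalCDF t) := by
    have := one_add_mul_le_pow (a := normalCDF t - 1) (by linarith [normalCDF_pos t]) N
    rw [add_sub_cancel] at this
    linarith
  simp_rw [← Finset.sum_div] at hsmall
  rw [div_lt_one hQ] at hsmall
  rw [Finset.sum_sub_distrib, Finset.sum_const, Finset.card_univ, nsmul_eq_mul, h2] at h1
  have h4 : (N : ℝ) + 1 ≤ Fintype.card ι := by exact_mod_cast hlt
  nlinarith

end Tail

/-! ### The bound for finite decompositions of the identity -/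

/-- The integrand is at least `1 - Φ(t)² - Φ(-t)² = 2 Φ(t) Φ(-t)`. -/
lemma gaussianMaxMean_pos {N : ℕ} (hN : 2 ≤ N) : 0 < gaussianMaxMean N := by
  have hpos : ∀ t, 0 < 1 - normalCDF t ^ N - normalCDF (-t) ^ N := by
    intro t
    have h1 := pow_le_pow_of_le_one (normalCDF_pos t).le (normalCDF_lt_one t).le hN
    have h2 := pow_le_pow_of_le_one (normalCDF_pos (-t)).le (normalCDF_lt_one (-t)).le hN
    rw [normalCDF_neg] at h2 ⊢
    nlinarith [mul_pos (normalCDF_pos t) (sub_pos.2 (normalCDF_lt_one t))]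
  rw [gaussianMaxMean, setIntegral_pos_iff_support_of_nonneg_ae
    (Filter.Eventually.of_forall fun t => (hpos t).le) (integrableOn_gaussianMax (by omega))]
  have : Function.support (fun t => 1 - normalCDF t ^ N - normalCDF (-t) ^ N) = Set.univ := by
    ext t; simpa using (hpos t).ne'
  rw [this]; simp

/-- The vector `(x, s)` of the Euclidean space `F × ℝ`. -/
def liftVec {F : Type*} (s : ℝ) (x : F) : WithLp 2 (F × ℝ) := WithLp.toLp 2 (x, s)

lemma liftVec_injective {F : Type*} (s : ℝ) :
    Function.Injective (liftVec s : F → WithLp 2 (F × ℝ)) := by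
  intro x y h
  exact congrArg WithLp.fst h

section Inner

variable {F : Type*} [NormedAddCommGroup F] [InnerProductSpace ℝ F]

lemma inner_liftVec (s : ℝ) (x : F) (y : WithLp 2 (F × ℝ)) :
    ⟪liftVec s x, y⟫ = ⟪x, y.fst⟫ + s * y.snd := by
  simp [liftVec, WithLp.prod_inner_apply, mul_comm]

lemma norm_liftVec_sq (s : ℝ) (x : F) : ‖liftVec s x‖ ^ 2 = ‖x‖ ^ 2 + s ^ 2 := by
  rw [← real_inner_self_eq_norm_sq, inner_liftVec]
  simp [liftVec, sq]

end Inner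

/-- The identity `2σ³ - 3sσ² + s³ = (σ - s)²(2σ + s)`, summed with weights. It shows that
`∑ cᵢ σᵢ³ ≥ s ∑ cᵢ σᵢ²`, with equality only if every `σᵢ` is `s`. -/
lemma sum_weights_mul_eq {ι : Type*} [Fintype ι] {c σ : ι → ℝ} {n N s : ℝ}
    (hN : ∑ i, c i * σ i ^ 2 = N) (hn : ∑ i, c i = n)
    (hs : s ^ 2 * n = N) :
    2 * (∑ i, c i * σ i ^ 2 * σ i - s * N) = ∑ i, c i * ((σ i - s) ^ 2 * (2 * σ i + s)) := by
  have h : ∀ i, c i * ((σ i - s) ^ 2 * (2 * σ i + s))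
      = 2 * (c i * σ i ^ 2 * σ i) - 3 * s * (c i * σ i ^ 2) + s ^ 3 * c i := fun i => by ring
  simp_rw [h, Finset.sum_add_distrib, Finset.sum_sub_distrib, ← Finset.mul_sum, hN, hn]
  linear_combination (-s) * hs

/-- The lifted vectors `(xᵢ, 1/√n)` decompose the identity of `F × ℝ`. -/
lemma sum_liftVec {F : Type*} [NormedAddCommGroup F] [InnerProductSpace ℝ F] {ι : Type*}
    [Fintype ι] {x : ι → F} {c : ι → ℝ} {n : ℝ} (hn : 0 < n) (hsum : ∑ i, c i = n)
    (hcent : ∑ i, c i • x i = 0) (hid : ∀ y, ∑ i, (c i * ⟪x i, y⟫) • x i = y) (y : WithLp 2 (F × ℝ)) :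
    ∑ i, (c i * ⟪liftVec (√n)⁻¹ (x i), y⟫) • liftVec (√n)⁻¹ (x i) = y := by
  have hn2 : (√n)⁻¹ * (√n)⁻¹ * n = 1 := by
    rw [← mul_inv, Real.mul_self_sqrt hn.le, inv_mul_cancel₀ hn.ne']
  refine ext_inner_right ℝ fun z => ?_
  rw [sum_inner]
  have h1 : ⟪y, z⟫ = ⟪y.fst, z.fst⟫ + y.snd * z.snd := by
    simp [WithLp.prod_inner_apply, mul_comm]
  have h2 : ∑ i, c i * ⟪x i, y.fst⟫ * ⟪x i, z.fst⟫ = ⟪y.fst, z.fst⟫ := by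
    conv_rhs => rw [← hid y.fst, sum_inner]
    exact Finset.sum_congr rfl fun i _ => by rw [real_inner_smul_left]
  have h3 : ∀ u : F, ∑ i, c i * ⟪x i, u⟫ = 0 := fun u => by
    rw [← inner_zero_left (𝕜 := ℝ) u, ← hcent, sum_inner]
    exact Finset.sum_congr rfl fun i _ => by rw [real_inner_smul_left]
  have h4 : ∀ i, ⟪(c i * ⟪liftVec (√n)⁻¹ (x i), y⟫) • liftVec (√n)⁻¹ (x i), z⟫
      = c i * ⟪x i, y.fst⟫ * ⟪x i, z.fst⟫ + (√n)⁻¹ * z.snd * (c i * ⟪x i, y.fst⟫)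
        + (√n)⁻¹ * y.snd * (c i * ⟪x i, z.fst⟫) + (√n)⁻¹ * (√n)⁻¹ * y.snd * z.snd * c i := by
    intro i
    rw [real_inner_smul_left, inner_liftVec, inner_liftVec]; ring
  simp_rw [h4, Finset.sum_add_distrib, ← Finset.mul_sum, h2, h3, hsum, h1]
  linear_combination y.snd * z.snd * hn2

section Lift

variable {F : Type*} [NormedAddCommGroup F] [InnerProductSpace ℝ F] {ι : Type*}

variable [FiniteDimensional ℝ F]

instance : FiniteDimensional ℝ (WithLp 2 (F × ℝ)) :=
  (WithLp.linearEquiv 2 ℝ (F × ℝ)).symm.finiteDimensional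

lemma finrank_withLp_prod : Module.finrank ℝ (WithLp 2 (F × ℝ)) = Module.finrank ℝ F + 1 := by
  rw [(WithLp.linearEquiv 2 ℝ (F × ℝ)).finrank_eq, Module.finrank_prod, Module.finrank_self]

variable [MeasurableSpace F] [BorelSpace F] [Fintype ι] [Nonempty ι]

/-- Adding the same independent centred variable to all members of a family does not change the
expectation of the maximum. -/
lemma integral_maxInner_liftVec (s : ℝ) (x : ι → F) :
    ∫ y, maxInner (fun i => liftVec s (x i)) y ∂(stdGaussian (WithLp 2 (F × ℝ)))
      = ∫ y, maxInner x y ∂(stdGaussian F) := by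
  have hmap := stdGaussian_map_of_adjoint (WithLp.fstL 2 ℝ F ℝ) (liftVec 0)
    (fun y u => by rw [real_inner_comm, real_inner_comm (liftVec 0 u), inner_liftVec]; simp)
    (fun u => by
      rw [← sq_eq_sq₀ (norm_nonneg _) (norm_nonneg _), norm_liftVec_sq]; simp)
  have hmax : ∀ y : WithLp 2 (F × ℝ), maxInner (fun i => liftVec s (x i)) y
      = maxInner x (WithLp.fstL 2 ℝ F ℝ y) + innerSL ℝ (liftVec s (0 : F)) y := by
    intro y
    have h1 : ∀ i, ⟪liftVec s (x i), y⟫ = ⟪x i, WithLp.fstL 2 ℝ F ℝ y⟫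
        + innerSL ℝ (liftVec s (0 : F)) y := fun i => by
      simp only [inner_liftVec, innerSL_apply_apply, WithLp.fstL_apply, inner_zero_left, zero_add]
    refine le_antisymm (maxInner_le_iff.2 fun i => ?_) ?_
    · rw [h1]
      exact add_le_add_left (inner_le_maxInner x _ i) _
    · obtain ⟨i, hi⟩ := exists_maxInner_eq x (WithLp.fstL 2 ℝ F ℝ y)
      rw [hi, ← h1]
      exact inner_le_maxInner (fun i => liftVec s (x i)) y i
  have hint : Integrable (fun y => maxInner x (WithLp.fstL 2 ℝ F ℝ y))
      (stdGaussian (WithLp 2 (F × ℝ))) := by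
    refine (integrable_map_measure (continuous_maxInner x).aestronglyMeasurable
      (by fun_prop)).1 ?_
    rw [hmap]; exact integrable_maxInner x
  simp_rw [hmax]
  have hint' : Integrable (innerSL ℝ (liftVec s (0 : F))) (stdGaussian (WithLp 2 (F × ℝ))) :=
    ContinuousLinearMap.integrable_comp _ IsGaussian.integrable_id
  rw [integral_add hint hint',
    integral_strongDual_stdGaussian, add_zero, ← hmap, integral_map (by fun_prop)
    (continuous_maxInner x).aestronglyMeasurable]

/-- The mean of the support function of a regular simplex inscribed in the unit ball. -/
lemma integral_maxInner_regularSimplex {k : ℕ} (hk : 1 ≤ k) (hF : Module.finrank ℝ F = k)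
    (hcard : Fintype.card ι = k + 1) {v : ι → F} (hv : ∀ i, ‖v i‖ = 1)
    (hvv : ∀ i j, i ≠ j → ⟪v i, v j⟫ = -(1 / k : ℝ)) :
    ∫ y, maxInner v y ∂(stdGaussian F) = √((k + 1) / k) * gaussianMaxMean (k + 1) := by
  have hk' : (0 : ℝ) < k := by exact_mod_cast hk
  -- Adding the coordinate `1/√k` makes the vertices orthogonal, of squared length `(k + 1)/k`.
  set s : ℝ := √(1 / k) with hs
  set r : ℝ := √((k + 1) / k) with hr
  have hs2 : s ^ 2 = 1 / k := Real.sq_sqrt (by positivity)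
  have hr2 : r ^ 2 = (k + 1) / k := Real.sq_sqrt (by positivity)
  have hr0 : 0 < r := Real.sqrt_pos.2 (by positivity)
  have hon : Orthonormal ℝ fun i => r⁻¹ • liftVec s (v i) := by
    refine ⟨fun i => ?_, fun i j hij => ?_⟩
    · rw [← sq_eq_sq₀ (norm_nonneg _) zero_le_one, norm_smul, mul_pow, norm_liftVec_sq, hv, hs2,
        norm_inv, Real.norm_of_nonneg hr0.le, inv_pow, hr2]
      field_simp
    · simp only
      rw [real_inner_smul_left, real_inner_smul_right, inner_liftVec]
      simp only [liftVec, WithLp.toLp_fst, WithLp.toLp_snd, hvv i j hij]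
      rw [← sq, hs2]; ring
  let b := (basisOfOrthonormalOfCardEqFinrank hon
    (by rw [finrank_withLp_prod, hF, hcard])).toOrthonormalBasis (by simpa using hon)
  have hb : (b : ι → WithLp 2 (F × ℝ)) = fun i => r⁻¹ • liftVec s (v i) := by simp [b]
  have h1 := (integral_maxInner_orthonormalBasis b).2
  have h2 : ∀ y, maxInner (fun i => liftVec s (v i)) y = r * maxInner b y := by
    intro y
    rw [hb, ← maxInner_const_smul _ hr0.le]
    simp [smul_smul, hr0.ne']
  rw [← integral_maxInner_liftVec s v]
  simp_rw [h2]
  rw [integral_const_mul, h1, hcard]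

/-- The sharp lower bound for the Gaussian mean of the support function of a centred, finitely
supported decomposition of the identity, with its equality case. -/
theorem le_integral_maxInner_of_isotropic {k : ℕ} {n : ℝ} {x : ι → F} {c : ι → ℝ} (hk : 1 ≤ k)
    (hF : Module.finrank ℝ F = k) (hn : 0 < n) (hc : ∀ i, 0 < c i) (hsum : ∑ i, c i = n)
    (hcent : ∑ i, c i • x i = 0) (hid : ∀ y, ∑ i, (c i * ⟪x i, y⟫) • x i = y) :
    √((k + 1) / n) * gaussianMaxMean (k + 1) ≤ ∫ y, maxInner x y ∂(stdGaussian F) ∧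
    (∫ y, maxInner x y ∂(stdGaussian F) = √((k + 1) / n) * gaussianMaxMean (k + 1) →
      Function.Injective x → Fintype.card ι = k + 1 ∧ (∀ i, ‖x i‖ ^ 2 = k / n) ∧
        ∀ i j, i ≠ j → ⟪x i, x j⟫ = -(1 / n)) := by
  -- The lifted vectors `z i = σ i • w i` decompose the identity with the weights `c i`, so the unit
  -- vectors `w i` do with the weights `d i = c i * σ i ^ 2`.
  set z : ι → WithLp 2 (F × ℝ) := fun i => liftVec (√n)⁻¹ (x i) with hz
  have hz2 : ∀ i, ‖z i‖ ^ 2 = ‖x i‖ ^ 2 + 1 / n := fun i => by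
    rw [hz, norm_liftVec_sq, inv_pow, Real.sq_sqrt hn.le, one_div]
  set σ : ι → ℝ := fun i => ‖z i‖ with hσ
  have hσpos : ∀ i, 0 < σ i := fun i => by
    have : 0 < ‖z i‖ ^ 2 := by rw [hz2]; positivity
    exact lt_of_le_of_ne (norm_nonneg _) fun h => by
      have h' : ‖z i‖ = 0 := h.symm
      rw [h'] at this
      norm_num at this
  obtain ⟨w, hw, hzw⟩ : ∃ w : ι → WithLp 2 (F × ℝ), (∀ i, ‖w i‖ = 1) ∧ ∀ i, z i = σ i • w i := by
    refine ⟨fun i => (σ i)⁻¹ • z i, fun i => ?_, fun i => ?_⟩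
    · rw [norm_smul, norm_inv, hσ, norm_norm, inv_mul_cancel₀ (hσpos i).ne']
    · rw [smul_smul, mul_inv_cancel₀ (hσpos i).ne', one_smul]
  set d : ι → ℝ := fun i => c i * σ i ^ 2 with hd'
  have hd : ∀ i, 0 < d i := fun i => mul_pos (hc i) (pow_pos (hσpos i) 2)
  have hdid : ∀ y, ∑ i, (d i * ⟪w i, y⟫) • w i = y := fun y => by
    conv_rhs => rw [← sum_liftVec hn hsum hcent hid y]
    refine Finset.sum_congr rfl fun i _ => ?_
    change _ = (c i * ⟪z i, y⟫) • z i
    rw [hzw, real_inner_smul_left, smul_smul]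
    congr 1
    simp only [hd']; ring
  have hfin : Module.finrank ℝ (WithLp 2 (F × ℝ)) = k + 1 := by rw [finrank_withLp_prod, hF]
  have hdN : ∑ i, c i * σ i ^ 2 = ((k + 1 : ℕ) : ℝ) := by
    rw [← hfin]; exact sum_weights_of_decomposition hw hdid
  have hkN : (0 : ℝ) < ((k + 1 : ℕ) : ℝ) := by positivity
  -- `s` is the common length of the `z i` in the extremal case: its square is the average of the
  -- `σ i ^ 2` for the weights `c i`.
  set s : ℝ := √((k + 1) / n) with hs
  have hspos : 0 < s := Real.sqrt_pos.2 (by positivity)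
  have hs2' : s ^ 2 = (k + 1) / n := Real.sq_sqrt (by positivity)
  have hs2 : s ^ 2 * n = ((k + 1 : ℕ) : ℝ) := by
    rw [hs2']; push_cast; field_simp
  have hm := gaussianMaxMean_pos (N := k + 1) (by omega)
  have hint : ∫ y, maxInner x y ∂(stdGaussian F)
      = ∫ y, maxInner (fun i => σ i • w i) y ∂(stdGaussian (WithLp 2 (F × ℝ))) := by
    rw [← integral_maxInner_liftVec (√n)⁻¹ x]
    simp_rw [← hzw]; rfl
  have hlow := le_integral_maxInner hd hw hdid hfin k.succ_pos hσpos
  rw [← hint] at hlow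
  have hiden := sum_weights_mul_eq hdN hsum hs2
  have hterm : ∀ i, 0 ≤ c i * ((σ i - s) ^ 2 * (2 * σ i + s)) := fun i =>
    mul_nonneg (hc i).le (mul_nonneg (sq_nonneg _) (by linarith [hσpos i]))
  have havg : ∑ i, d i / ((k + 1 : ℕ) : ℝ) * σ i = (∑ i, d i * σ i) / ((k + 1 : ℕ) : ℝ) := by
    rw [Finset.sum_div]
    exact Finset.sum_congr rfl fun i _ => by ring
  rw [havg] at hlow
  constructor
  · refine le_trans (mul_le_mul_of_nonneg_right ?_ hm.le) hlow
    rw [le_div_iff₀ hkN]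
    have := Finset.sum_nonneg fun i (_ : i ∈ Finset.univ) => hterm i
    linarith
  · intro heq hinj
    rw [heq, mul_le_mul_iff_left₀ hm, div_le_iff₀ hkN] at hlow
    have h0 : ∑ i, c i * ((σ i - s) ^ 2 * (2 * σ i + s)) = 0 :=
      le_antisymm (by linarith) (Finset.sum_nonneg fun i _ => hterm i)
    -- Equality forces equal lengths, and then equal means of the two maxima.
    have hσs : ∀ i, σ i = s := by
      intro i
      have h1 := (Finset.sum_eq_zero_iff_of_nonneg fun i _ => hterm i).1 h0 i (Finset.mem_univ i)
      have h2 := (mul_eq_zero.1 h1).resolve_left (hc i).ne'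
      have h3 := (mul_eq_zero.1 h2).resolve_right (by linarith [hσpos i])
      exact sub_eq_zero.1 (pow_eq_zero_iff two_ne_zero |>.1 h3)
    have hwinj : Function.Injective w := by
      intro i j hij
      apply hinj
      apply liftVec_injective (√n)⁻¹
      change z i = z j
      rw [hzw i, hzw j, hij, hσs i, hσs j]
    have hmean : ∫ y, maxInner w y ∂(stdGaussian (WithLp 2 (F × ℝ)))
        = gaussianMaxMean (k + 1) := by
      have h1 : ∀ y, maxInner (fun i => σ i • w i) y = s * maxInner w y := fun y => by
        rw [← maxInner_const_smul w hspos.le]; simp_rw [hσs]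
      simp_rw [h1] at hint
      rw [integral_const_mul, heq] at hint
      exact (mul_left_cancel₀ hspos.ne' hint).symm
    have hcard := card_le_of_frequently_distribution_eq hw hwinj
      (frequently_distribution_eq hd hw hdid hfin k.succ_pos hmean)
    rw [← hfin] at hcard
    obtain ⟨hon, hcard'⟩ := orthonormal_of_decomposition_of_card_le hd hw hdid hcard
    refine ⟨hcard'.trans hfin, fun i => ?_, fun i j hij => ?_⟩
    · have h1 := hz2 i
      have h2 : ‖z i‖ = s := hσs i
      rw [h2, hs2'] at h1
      have : ‖x i‖ ^ 2 = (k + 1) / n - 1 / n := by linarith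
      rw [this]; ring
    · have h1 : ⟪z i, z j⟫ = 0 := by
        rw [hzw i, hzw j, real_inner_smul_left, real_inner_smul_right, hon.2 hij]; simp
      rw [hz, inner_liftVec] at h1
      simp only [liftVec, WithLp.toLp_fst, WithLp.toLp_snd] at h1
      rw [← mul_inv, Real.mul_self_sqrt hn.le] at h1
      rw [one_div]; linarith

end Lift

/-! ### Gram matrices and regular simplices -/

section Gram

variable {V W : Type*} [NormedAddCommGroup V] [InnerProductSpace ℝ V] [NormedAddCommGroup W]
  [InnerProductSpace ℝ W] {ι : Type*} [Fintype ι]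

lemma norm_sum_smul_eq_of_gram {v : ι → V} {u : ι → W} (h : ∀ i j, ⟪u i, u j⟫ = ⟪v i, v j⟫)
    (a : ι → ℝ) : ‖∑ i, a i • u i‖ = ‖∑ i, a i • v i‖ := by
  rw [← sq_eq_sq₀ (norm_nonneg _) (norm_nonneg _), ← real_inner_self_eq_norm_sq,
    ← real_inner_self_eq_norm_sq]
  simp_rw [sum_inner, inner_sum, real_inner_smul_left, real_inner_smul_right, h]

/-- Families with equal Gram matrices correspond under a linear isometry, provided that the first
one gives a decomposition of the identity and the dimensions agree. -/
lemma exists_linearIsometryEquiv_of_gram [FiniteDimensional ℝ V] [FiniteDimensional ℝ W]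
    (hVW : Module.finrank ℝ V = Module.finrank ℝ W) {v : ι → V} {u : ι → W}
    (h : ∀ i j, ⟪u i, u j⟫ = ⟪v i, v j⟫) {a : ℝ} (hid : ∀ y, ∑ i, (a * ⟪v i, y⟫) • v i = y) :
    ∃ L : V ≃ₗᵢ[ℝ] W, ∀ i, L (v i) = u i := by
  classical
  let T : V →ₗ[ℝ] W := ∑ i, (a • (innerSL ℝ (v i) : V →ₗ[ℝ] ℝ)).smulRight (u i)
  have hT : ∀ y, T y = ∑ i, (a * ⟪v i, y⟫) • u i := fun y => by
    simp [T]
  let L : V →ₗᵢ[ℝ] W := ⟨T, fun y => by rw [hT, norm_sum_smul_eq_of_gram h, hid]⟩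
  refine ⟨L.toLinearIsometryEquiv hVW, fun j => ?_⟩
  rw [LinearIsometry.coe_toLinearIsometryEquiv]
  change T (v j) = u j
  have h1 := norm_sum_smul_eq_of_gram h fun i => a * ⟪v i, v j⟫ - if i = j then 1 else 0
  simp_rw [sub_smul, Finset.sum_sub_distrib, hid] at h1
  simp only [ite_smul, one_smul, zero_smul, Finset.sum_ite_eq', Finset.mem_univ, if_true,
    sub_self, norm_zero, norm_eq_zero] at h1
  rw [hT]
  exact sub_eq_zero.1 h1

end Gram

section Simplex

variable {V : Type*} [NormedAddCommGroup V] [InnerProductSpace ℝ V] [FiniteDimensional ℝ V] {k : ℕ}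

lemma eq_zero_of_inner_simplex_eq (hV : Module.finrank ℝ V = k) (s : Affine.Simplex ℝ V k) {z : V}
    {a : ℝ} (h : ∀ i, ⟪z, s.points i⟫ = a) : z = 0 := by
  have htop := s.independent.vectorSpan_eq_top_of_card_eq_finrank_add_one (by simp [hV])
  have hle : vectorSpan ℝ (Set.range s.points) ≤ (innerSL ℝ z : V →ₗ[ℝ] ℝ).ker := by
    refine Submodule.span_le.2 ?_
    rintro _ ⟨_, ⟨i, rfl⟩, _, ⟨j, rfl⟩, rfl⟩
    simp [inner_sub_right, h]
  have hz : z ∈ vectorSpan ℝ (Set.range s.points) := by rw [htop]; trivial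
  simpa using hle hz

/-- The Gram matrix of a regular simplex inscribed in the unit sphere, and the decomposition of the
identity given by its vertices. -/
lemma regularSimplex_inner (hk : 1 ≤ k) (hV : Module.finrank ℝ V = k) (s : Affine.Simplex ℝ V k)
    (heq : s.Equilateral) (hs : ∀ i, ‖s.points i‖ = 1) :
    (∀ i j, i ≠ j → ⟪s.points i, s.points j⟫ = -(1 / k : ℝ)) ∧
      ∑ i, s.points i = 0 ∧
      ∀ y, ∑ i, ((k / (k + 1) : ℝ) * ⟪s.points i, y⟫) • s.points i = y := by
  have hk' : (0 : ℝ) < k := by exact_mod_cast hk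
  set v := s.points with hv
  obtain ⟨r, hr⟩ := heq
  have hin : ∀ i j, i ≠ j → ⟪v i, v j⟫ = 1 - r ^ 2 / 2 := by
    intro i j hij
    have h1 := hr i j hij
    rw [dist_eq_norm] at h1
    have h2 := norm_sub_sq_real (v i) (v j)
    rw [h1, hs, hs] at h2
    linarith
  set b : ℝ := 1 - r ^ 2 / 2 with hb
  have hgram : ∀ i j, ⟪v i, v j⟫ = b + if i = j then 1 - b else 0 := by
    intro i j
    split_ifs with h
    · rw [h, real_inner_self_eq_norm_sq, hs]; ring
    · rw [hin i j h]; ring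
  have hsum : ∑ i, v i = 0 := by
    refine eq_zero_of_inner_simplex_eq hV s (a := (k + 1) * b + (1 - b)) fun j => ?_
    rw [sum_inner]
    simp_rw [← hv, hgram, Finset.sum_add_distrib]
    simp
  have hbk : (k + 1) * b + (1 - b) = 0 := by
    have h1 : ⟪∑ i, v i, v 0⟫ = (k + 1) * b + (1 - b) := by
      rw [sum_inner]
      simp_rw [hgram, Finset.sum_add_distrib]
      simp
    rw [← h1, hsum, inner_zero_left]
  have hb' : b = -(1 / k : ℝ) := by field_simp; linarith
  refine ⟨fun i j hij => by rw [hin i j hij, hb'], hsum, fun y => ?_⟩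
  rw [← sub_eq_zero]
  refine eq_zero_of_inner_simplex_eq hV s (a := 0) fun j => ?_
  have h1 : ∑ i, ⟪v i, y⟫ = 0 := by rw [← sum_inner, hsum, inner_zero_left]
  rw [inner_sub_left, sum_inner]
  simp_rw [← hv, real_inner_smul_left, hgram, mul_add, Finset.sum_add_distrib]
  simp only [mul_ite, mul_zero, Finset.sum_ite_eq', Finset.mem_univ, if_true]
  rw [← Finset.sum_mul, ← Finset.mul_sum, h1, real_inner_comm y, hb']
  field_simp
  ring

end Simplex

/-! ### Polars and their `ℓ`-norms -/

section Polar

variable {F : Type*} [NormedAddCommGroup F] [InnerProductSpace ℝ F]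

lemma polarBody_convexHull (S : Set F) : polarBody (convexHull ℝ S) = polarBody S := by
  ext x
  refine ⟨fun h y hy => h y (subset_convexHull ℝ S hy), fun h y hy => ?_⟩
  have hconv : Convex ℝ {y : F | ⟪x, y⟫ ≤ 1} :=
    convex_halfSpace_le (innerSL ℝ x : F →ₗ[ℝ] ℝ).isLinear 1
  exact convexHull_min (fun y hy => h y hy) hconv hy

lemma convex_polarBody (S : Set F) : Convex ℝ (polarBody S) := by
  intro x hx y hy a b ha hb hab z hz
  rw [inner_add_left, real_inner_smul_left, real_inner_smul_left]
  have h1 := mul_le_mul_of_nonneg_left (hx z hz) ha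
  have h2 := mul_le_mul_of_nonneg_left (hy z hz) hb
  linarith

lemma isClosed_polarBody (S : Set F) : IsClosed (polarBody S) := by
  have : polarBody S = ⋂ y ∈ S, {x | ⟪x, y⟫ ≤ 1} := by ext x; simp [polarBody]
  rw [this]
  exact isClosed_biInter fun y _ => isClosed_le (by fun_prop) continuous_const

lemma ball_subset_polarBody {S : Set F} (hS : ∀ x ∈ S, ‖x‖ ≤ 1) : ball 0 1 ⊆ polarBody S := by
  intro x hx y hy
  have h1 := mem_ball_zero_iff.1 hx
  exact (real_inner_le_norm x y).trans (mul_le_one₀ h1.le (norm_nonneg _) (hS y hy))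

lemma polarBody_mem_nhds {S : Set F} (hS : ∀ x ∈ S, ‖x‖ ≤ 1) : polarBody S ∈ nhds 0 :=
  Filter.mem_of_superset (ball_mem_nhds 0 one_pos) (ball_subset_polarBody hS)

lemma continuous_gauge_polarBody {S : Set F} (hS : ∀ x ∈ S, ‖x‖ ≤ 1) :
    Continuous (gauge (polarBody S)) :=
  continuous_gauge (convex_polarBody S) (polarBody_mem_nhds hS)

lemma gauge_polarBody_anti {S T : Set F} (hT : ∀ x ∈ T, ‖x‖ ≤ 1) (hST : S ⊆ T) (y : F) :
    gauge (polarBody S) y ≤ gauge (polarBody T) y :=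
  gauge_mono (absorbent_nhds_zero (polarBody_mem_nhds hT)) (fun _ hx z hz => hx z (hST hz)) y

variable {ι : Type*} [Fintype ι] [Nonempty ι]

lemma maxInner_nonneg {x : ι → F} {c : ι → ℝ} (hc : ∀ i, 0 < c i) (hcent : ∑ i, c i • x i = 0)
    (y : F) : 0 ≤ maxInner x y := by
  by_contra! hlt
  have h1 : ∑ i, c i * ⟪x i, y⟫ = 0 := by
    rw [← inner_zero_left (𝕜 := ℝ) y, ← hcent, sum_inner]
    exact Finset.sum_congr rfl fun i _ => by rw [real_inner_smul_left]
  have h2 : ∑ i, c i * ⟪x i, y⟫ < 0 := Finset.sum_neg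
    (fun i _ => mul_neg_of_pos_of_neg (hc i) ((inner_le_maxInner x y i).trans_lt hlt))
    Finset.univ_nonempty
  exact h2.ne h1

/-- The Minkowski functional of the polar of a finite set whose convex hull contains the origin is
the support function of that set. -/
lemma gauge_polarBody_range {x : ι → F} {c : ι → ℝ} (hc : ∀ i, 0 < c i)
    (hcent : ∑ i, c i • x i = 0) (y : F) :
    gauge (polarBody (Set.range x)) y = maxInner x y := by
  have h0 := maxInner_nonneg hc hcent y
  have hmem : ∀ r : ℝ, 0 < r → (r⁻¹ • y ∈ polarBody (Set.range x) ↔ maxInner x y ≤ r) := by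
    intro r hr
    rw [maxInner_le_iff]
    simp only [polarBody, Set.mem_ofPred_eq, Set.forall_mem_range, real_inner_smul_left]
    refine forall_congr' fun i => ?_
    rw [inv_mul_le_iff₀ hr, mul_one, real_inner_comm]
  rw [gauge_def']
  refine le_antisymm (le_of_forall_pos_le_add fun ε hε => ?_) ?_
  · have hpos : 0 < maxInner x y + ε := by linarith
    exact csInf_le ⟨0, fun r hr => (Set.mem_Ioi.1 hr.1).le⟩
      ⟨hpos, (hmem _ hpos).2 (by linarith)⟩
  · have hpos : 0 < maxInner x y + 1 := by linarith
    refine le_csInf ⟨_, hpos, (hmem _ hpos).2 (by linarith)⟩ fun r hr => ?_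
    exact (hmem r hr.1).1 hr.2

/-- If the Gram matrices of two families agree up to the factor `r²`, their polars are related by a
linear isometry and the dilation by `r`. -/
lemma exists_polarBody_eq_image {V W ι κ : Type*} [NormedAddCommGroup V] [InnerProductSpace ℝ V]
    [NormedAddCommGroup W] [InnerProductSpace ℝ W] [FiniteDimensional ℝ V] [FiniteDimensional ℝ W]
    [Fintype κ] (hVW : Module.finrank ℝ V = Module.finrank ℝ W) {v : κ → V} {x : ι → W} (e : κ ≃ ι)
    {r : ℝ} (hr : 0 < r) (hgram : ∀ i j, r * r * ⟪x (e i), x (e j)⟫ = ⟪v i, v j⟫) {a : ℝ}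
    (hid : ∀ y, ∑ i, (a * ⟪v i, y⟫) • v i = y) :
    ∃ L : V ≃ₗᵢ[ℝ] W, polarBody (Set.range x) = L '' (r • polarBody (Set.range v)) := by
  obtain ⟨L, hL⟩ := exists_linearIsometryEquiv_of_gram hVW (u := fun i => r • x (e i))
    (fun i j => by rw [real_inner_smul_left, real_inner_smul_right, ← mul_assoc, hgram]) hid
  refine ⟨L, ?_⟩
  ext y
  have hmem : y ∈ L '' (r • polarBody (Set.range v)) ↔
      r⁻¹ • L.symm y ∈ polarBody (Set.range v) := by
    rw [← Set.mem_smul_set_iff_inv_smul_mem₀ hr.ne']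
    constructor
    · rintro ⟨z, hz, rfl⟩
      simpa using hz
    · intro hz
      exact ⟨_, hz, by simp⟩
  rw [hmem]
  simp only [polarBody, Set.mem_ofPred_eq, Set.forall_mem_range]
  rw [← e.forall_congr_right (q := fun i => ⟪y, x i⟫ ≤ 1)]
  refine forall_congr' fun i => ?_
  have h2 : ⟪r⁻¹ • L.symm y, v i⟫ = ⟪y, x (e i)⟫ := by
    rw [← L.inner_map_map, map_smul, L.apply_symm_apply, hL, real_inner_smul_left,
      real_inner_smul_right, ← mul_assoc, inv_mul_cancel₀ hr.ne', one_mul]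
  rw [h2]

end Polar

lemma ellNorm_smul {F : Type*} [NormedAddCommGroup F] [InnerProductSpace ℝ F]
    [FiniteDimensional ℝ F] [MeasurableSpace F] {r : ℝ} (hr : 0 ≤ r) (A : Set F) :
    ellNorm (r • A) = r⁻¹ * ellNorm A := by
  rw [ellNorm, ellNorm, ← integral_const_mul]
  rw [gauge_smul_left_of_nonneg hr]
  rfl

section EllNorm

variable {F : Type*} [NormedAddCommGroup F] [InnerProductSpace ℝ F] [FiniteDimensional ℝ F]
  [MeasurableSpace F] [BorelSpace F]

instance : (stdGaussian F).IsOpenPosMeasure := by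
  refine Measure.IsOpenPosMeasure.mk fun U hU hne h0 => hU.measure_ne_zero volume hne ?_
  rw [stdGaussian_eq_withDensity] at h0
  refine withDensity_absolutelyContinuous' (by fun_prop)
    (Filter.Eventually.of_forall fun x => ?_) h0
  have : 0 < (2 * Real.pi) ^ (-(Module.finrank ℝ F / 2 : ℝ)) * Real.exp (-(1 / 2) * ‖x‖ ^ 2) := by
    positivity
  simpa using this

lemma integrable_gauge_polarBody {S : Set F} (hS : ∀ x ∈ S, ‖x‖ ≤ 1) :
    Integrable (gauge (polarBody S)) (stdGaussian F) := by
  have hi : Integrable (fun y : F => ‖y‖) (stdGaussian F) :=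
    (IsGaussian.integrable_id (μ := stdGaussian F)).norm
  refine hi.mono' (continuous_gauge_polarBody hS).aestronglyMeasurable
    (Filter.Eventually.of_forall fun y => ?_)
  rw [Real.norm_of_nonneg (gauge_nonneg _)]
  simpa using mul_gauge_le_norm (ball_subset_polarBody hS) (x := y)

lemma ellNorm_polarBody_anti {S T : Set F} (hT : ∀ x ∈ T, ‖x‖ ≤ 1) (hST : S ⊆ T) :
    ellNorm (polarBody S) ≤ ellNorm (polarBody T) :=
  integral_mono (integrable_gauge_polarBody fun x hx => hT x (hST hx))
    (integrable_gauge_polarBody hT) (gauge_polarBody_anti hT hST)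

/-- Nested polars with equal `ℓ`-norms are equal. -/
lemma polarBody_eq_of_ellNorm_eq {S T : Set F} (hT : ∀ x ∈ T, ‖x‖ ≤ 1) (hST : S ⊆ T)
    (h : ellNorm (polarBody S) = ellNorm (polarBody T)) : polarBody S = polarBody T := by
  have hS : ∀ x ∈ S, ‖x‖ ≤ 1 := fun x hx => hT x (hST hx)
  have hae : gauge (polarBody S) =ᵐ[stdGaussian F] gauge (polarBody T) :=
    (integral_eq_iff_of_ae_le (integrable_gauge_polarBody hS) (integrable_gauge_polarBody hT)
      (Filter.Eventually.of_forall (gauge_polarBody_anti hT hST))).1 h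
  have heq : gauge (polarBody S) = gauge (polarBody T) :=
    ((continuous_gauge_polarBody hS).ae_eq_iff_eq _ (continuous_gauge_polarBody hT)).1 hae
  ext x
  rw [← (isClosed_polarBody S).closure_eq, ← (isClosed_polarBody T).closure_eq,
    ← gauge_le_one_iff_mem_closure (convex_polarBody S) (polarBody_mem_nhds hS),
    ← gauge_le_one_iff_mem_closure (convex_polarBody T) (polarBody_mem_nhds hT), heq]

lemma ellNorm_image {G : Type*} [NormedAddCommGroup G] [InnerProductSpace ℝ G]
    [FiniteDimensional ℝ G] [MeasurableSpace G] [BorelSpace G] (L : F ≃ₗᵢ[ℝ] G) (A : Set F) :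
    ellNorm (L '' A) = ellNorm A := by
  have hg : ∀ y, gauge (L '' A) (L y) = gauge A y := by
    intro y
    rw [gauge_def', gauge_def']
    simp_rw [← map_smul, L.injective.mem_set_image]
  rw [ellNorm, ellNorm, ← stdGaussian_map L]
  exact (L.toHomeomorph.measurableEmbedding.integral_map _).trans
    (integral_congr_ae (Filter.Eventually.of_forall hg))

end EllNorm

/-- The `ℓ`-norm of the polar of an inscribed regular simplex. -/
lemma ellNorm_polarBody_regularSimplex {k : ℕ} (hk : 1 ≤ k)
    (s : Affine.Simplex ℝ (EuclideanSpace ℝ (Fin k)) k) (heq : s.Equilateral)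
    (hs : ∀ i, ‖s.points i‖ = 1) :
    ellNorm (polarBody (convexHull ℝ (Set.range s.points)))
      = √((k + 1) / k) * gaussianMaxMean (k + 1) := by
  have hV : Module.finrank ℝ (EuclideanSpace ℝ (Fin k)) = k := finrank_euclideanSpace_fin
  obtain ⟨h1, h2, -⟩ := regularSimplex_inner hk hV s heq hs
  rw [polarBody_convexHull, ellNorm, ← integral_maxInner_regularSimplex hk hV (by simp) hs h1]
  refine integral_congr_ae (Filter.Eventually.of_forall fun y => ?_)
  exact gauge_polarBody_range (c := fun _ => 1) (fun _ => one_pos) (by simpa using h2) y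

/-! ### Reduction to finitely many points -/

/-- In finite dimension the convex hull of a compact set is compact, since by Carathéodory's theorem
convex combinations of boundedly many points suffice. -/
lemma isCompact_convexHull_of_finiteDimensional {V : Type*} [NormedAddCommGroup V]
    [NormedSpace ℝ V] [FiniteDimensional ℝ V] {S : Set V} (hS : IsCompact S) :
    IsCompact (convexHull ℝ S) := by
  have h : convexHull ℝ S = ⋃ m ∈ Finset.range (Module.finrank ℝ V + 2),
      (fun a : (Fin m → ℝ) × (Fin m → V) => ∑ i, a.1 i • a.2 i) ''
        (stdSimplex ℝ (Fin m) ×ˢ Set.univ.pi fun _ => S) := by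
    refine Set.Subset.antisymm (fun x hx => ?_) (Set.iUnion₂_subset fun m _ => ?_)
    · obtain ⟨ι, hι, z, w, hz, haff, hw, hw1, hwz⟩ := eq_pos_convex_span_of_mem_convexHull hx
      let e := Fintype.equivFin ι
      refine Set.mem_biUnion (x := Fintype.card ι) ?_ ⟨(w ∘ e.symm, z ∘ e.symm), ⟨⟨?_, ?_⟩, ?_⟩, ?_⟩
      · have h1 := haff.card_le_finrank_succ
        have h2 := (vectorSpan ℝ (Set.range z)).finrank_le
        simp only [Finset.coe_range, Set.mem_Iio]
        omega
      · exact fun i => (hw _).le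
      · rw [← hw1]
        exact e.symm.sum_comp w
      · exact fun i _ => hz ⟨_, rfl⟩
      · rw [← hwz]
        exact e.symm.sum_comp fun i => w i • z i
    · rintro _ ⟨⟨w, z⟩, ⟨hw, hz⟩, rfl⟩
      exact (convex_convexHull ℝ S).sum_mem (fun i _ => hw.1 i) hw.2
        fun i _ => subset_convexHull ℝ S (hz i trivial)
  rw [h]
  refine (Finset.range _).isCompact_biUnion fun m _ => IsCompact.image ?_ (by fun_prop)
  exact (isCompact_stdSimplex ℝ (Fin m)).prod (isCompact_univ_pi fun _ => hS)

lemma continuous_rankOne_self {W : Type*} [NormedAddCommGroup W] [InnerProductSpace ℝ W] :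
    Continuous fun x : W => InnerProductSpace.rankOne ℝ x x :=
  (ContinuousLinearMap.continuous₂ (InnerProductSpace.rankOne ℝ (E := W) (F := W))).comp
    (continuous_id.prodMk continuous_id)

/-- By Carathéodory's theorem, a centred decomposition of the identity given by a finite measure on
a compact space may be replaced by a positive combination of finitely many distinct points in the
image of the support. -/
lemma exists_finite_decomposition.{u, v} {W : Type u} [NormedAddCommGroup W] [InnerProductSpace ℝ W]
    [FiniteDimensional ℝ W] {X : Type v} [MetricSpace X] [CompactSpace X] [MeasurableSpace X]
    [BorelSpace X] {μ : Measure X} [IsFiniteMeasure μ] {p : X → W} (hp : Continuous p) {m : ℝ}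
    (hm : 0 < m) (hmass : μ.real Set.univ = m) (hcent : ∫ u, p u ∂μ = 0)
    (hiso : ∀ y z, ∫ u, ⟪p u, y⟫ * ⟪p u, z⟫ ∂μ = ⟪y, z⟫) :
    ∃ (ι : Type u) (_ : Fintype ι) (x : ι → W) (c : ι → ℝ), Function.Injective x ∧
      (∀ i, x i ∈ p '' μ.support) ∧ (∀ i, 0 < c i) ∧ ∑ i, c i = m ∧ ∑ i, c i • x i = 0 ∧
      ∀ y, ∑ i, (c i * ⟪x i, y⟫) • x i = y := by
  have hne : NeZero μ := ⟨by rintro rfl; simp at hmass; linarith⟩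
  -- The average of `q ∘ p` is `m⁻¹ • (id, 0)`, a point of the convex hull of a compact set.
  set q : W → (W →L[ℝ] W) × W := fun x => (InnerProductSpace.rankOne ℝ x x, x) with hq
  have hqc : Continuous q := continuous_rankOne_self.prodMk continuous_id
  have hint1 : Integrable (fun u => InnerProductSpace.rankOne ℝ (p u) (p u)) μ :=
    (continuous_rankOne_self.comp hp).integrable_of_hasCompactSupport (.of_compactSpace _)
  have hint2 : Integrable p μ := hp.integrable_of_hasCompactSupport (.of_compactSpace _)
  have hint : Integrable (fun u => q (p u)) μ := hint1.prodMk hint2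
  have hcomp : IsCompact (q '' (p '' μ.support)) :=
    (Measure.isClosed_support.isCompact.image hp).image hqc
  have hmem := (convex_convexHull ℝ (q '' (p '' μ.support))).average_mem
    (isCompact_convexHull_of_finiteDimensional hcomp).isClosed
    (f := fun u => q (p u)) (Filter.mem_of_superset Measure.support_mem_ae fun u hu =>
      subset_convexHull ℝ _ ⟨p u, ⟨u, hu, rfl⟩, rfl⟩) hint
  have hid : ∫ u, InnerProductSpace.rankOne ℝ (p u) (p u) ∂μ = ContinuousLinearMap.id ℝ W := by
    refine ContinuousLinearMap.ext fun y => ext_inner_left ℝ fun z => ?_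
    rw [ContinuousLinearMap.integral_apply hint1]
    have hint' := (ContinuousLinearMap.apply ℝ W y).integrable_comp hint1
    have h2 := ContinuousLinearMap.integral_comp_comm (innerSL ℝ z) hint'
    simp only [ContinuousLinearMap.apply_apply, InnerProductSpace.rankOne_apply,
      innerSL_apply_apply, real_inner_smul_right] at h2 ⊢
    rw [← h2, ContinuousLinearMap.id_apply, real_inner_comm, ← hiso]
    refine integral_congr_ae (Filter.Eventually.of_forall fun u => ?_)
    simp only [real_inner_comm z]
  obtain ⟨ι, hι, z, w, hz, haff, hw, hw1, hwz⟩ := eq_pos_convex_span_of_mem_convexHull hmem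
  have hx : ∀ i, ∃ x ∈ p '' μ.support, q x = z i := fun i => hz ⟨i, rfl⟩
  choose x hxS hxz using hx
  have havg : ∑ i, w i • q (x i) = m⁻¹ • (ContinuousLinearMap.id ℝ W, (0 : W)) := by
    simp_rw [hxz, hwz]
    rw [average_eq, hmass, ← hid, ← hcent, ← integral_pair hint1 hint2]
  have h1 : ∑ i, w i • InnerProductSpace.rankOne ℝ (x i) (x i)
      = m⁻¹ • ContinuousLinearMap.id ℝ W := by
    simpa [hq, Prod.fst_sum] using congrArg Prod.fst havg
  have h2 : ∑ i, w i • x i = 0 := by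
    simpa [hq, Prod.snd_sum] using congrArg Prod.snd havg
  refine ⟨ι, hι, x, fun i => m * w i, fun i j hij => haff.injective ?_, hxS,
    fun i => mul_pos hm (hw i), ?_, ?_, fun y => ?_⟩
  · rw [← hxz, ← hxz, hij]
  · rw [← Finset.mul_sum, hw1, mul_one]
  · simp_rw [mul_smul]
    rw [← Finset.smul_sum, h2, smul_zero]
  · have h3 := congrArg (fun A : W →L[ℝ] W => A y) h1
    simp only [sum_apply, smul_apply,
      InnerProductSpace.rankOne_apply, ContinuousLinearMap.id_apply] at h3
    simp_rw [mul_assoc, mul_smul]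
    rw [← Finset.smul_sum, h3, smul_smul, mul_inv_cancel₀ hm.ne', one_smul]

section Reduction

variable {n : ℕ} {H : Submodule ℝ (EuclideanSpace ℝ (Fin n))}
  {μ : Measure (sphere (0 : EuclideanSpace ℝ (Fin n)) 1)}

/-- The projection to `H` of the support of a measure on the sphere. -/
def projSupport (H : Submodule ℝ (EuclideanSpace ℝ (Fin n)))
    (μ : Measure (sphere (0 : EuclideanSpace ℝ (Fin n)) 1)) : Set H :=
  (fun u : sphere (0 : EuclideanSpace ℝ (Fin n)) 1 => H.orthogonalProjectionOnto u) '' μ.support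

lemma inner_orthogonalProjectionOnto (u : EuclideanSpace ℝ (Fin n)) (y : H) :
    ⟪H.orthogonalProjectionOnto u, y⟫ = ⟪u, (y : EuclideanSpace ℝ (Fin n))⟫ :=
  H.inner_orthogonalProjectionOnto_eq_of_mem_right y u

/-- The section of a polar by `H` is the polar, within `H`, of the projection to `H`. -/
lemma sectionIn_polarBody_convSupport :
    sectionIn (polarBody (convSupport μ)) H = polarBody (projSupport H μ) := by
  rw [convSupport, polarBody_convexHull]
  ext y
  simp only [sectionIn, polarBody, projSupport, Set.mem_ofPred_eq, Set.forall_mem_image]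
  refine forall_congr' fun u => forall_congr' fun _ => ?_
  rw [real_inner_comm, ← inner_orthogonalProjectionOnto, real_inner_comm]

lemma norm_le_one_of_mem_projSupport : ∀ x ∈ projSupport H μ, ‖x‖ ≤ 1 := by
  rintro _ ⟨u, -, rfl⟩
  refine (H.norm_orthogonalProjectionOnto_apply_le _).trans (le_of_eq ?_)
  simp

variable [IsFiniteMeasure μ]

/-- Isotropy in coordinates: `∫ ⟪u, y⟫ ⟪u, z⟫ dμ(u) = ⟪y, z⟫`. -/
lemma integral_inner_mul_inner_of_isIsotropic (hiso : IsIsotropic μ)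
    (y z : EuclideanSpace ℝ (Fin n)) :
    ∫ u, ⟪(u : EuclideanSpace ℝ (Fin n)), y⟫ * ⟪(u : EuclideanSpace ℝ (Fin n)), z⟫ ∂μ = ⟪y, z⟫ := by
  have hcont : Continuous fun u : sphere (0 : EuclideanSpace ℝ (Fin n)) 1 =>
      InnerProductSpace.rankOne ℝ (u : EuclideanSpace ℝ (Fin n)) (u : EuclideanSpace ℝ (Fin n)) :=
    continuous_rankOne_self.comp continuous_subtype_val
  have hint := hcont.integrable_of_hasCompactSupport (μ := μ) (.of_compactSpace _)
  have h1 : (∫ u, InnerProductSpace.rankOne ℝ (u : EuclideanSpace ℝ (Fin n))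
      (u : EuclideanSpace ℝ (Fin n)) ∂μ) y = y := by rw [hiso]; rfl
  rw [ContinuousLinearMap.integral_apply hint] at h1
  have hint' := (ContinuousLinearMap.apply ℝ (EuclideanSpace ℝ (Fin n)) y).integrable_comp hint
  have h2 := ContinuousLinearMap.integral_comp_comm (innerSL ℝ z) hint'
  simp only [ContinuousLinearMap.apply_apply, InnerProductSpace.rankOne_apply,
    innerSL_apply_apply, real_inner_smul_right] at h1 h2
  rw [h1] at h2
  rw [real_inner_comm z y, ← h2]
  refine integral_congr_ae (Filter.Eventually.of_forall fun u => ?_)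
  simp only [real_inner_comm z]

/-- The trace of the isotropy condition. -/
lemma measureReal_univ_of_isIsotropic (hiso : IsIsotropic μ) : μ.real Set.univ = n := by
  let b := EuclideanSpace.basisFun (Fin n) ℝ
  have hint : ∀ i, Integrable (fun u : sphere (0 : EuclideanSpace ℝ (Fin n)) 1 =>
      ⟪(u : EuclideanSpace ℝ (Fin n)), b i⟫ * ⟪(u : EuclideanSpace ℝ (Fin n)), b i⟫) μ := fun i =>
    Continuous.integrable_of_hasCompactSupport (by fun_prop) (.of_compactSpace _)
  have h1 : ∫ u : sphere (0 : EuclideanSpace ℝ (Fin n)) 1, ∑ i,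
      ⟪(u : EuclideanSpace ℝ (Fin n)), b i⟫ * ⟪(u : EuclideanSpace ℝ (Fin n)), b i⟫ ∂μ = n := by
    rw [integral_finsetSum _ fun i _ => hint i]
    simp_rw [integral_inner_mul_inner_of_isIsotropic hiso]
    simp
  have h2 : ∀ u : sphere (0 : EuclideanSpace ℝ (Fin n)) 1, ∑ i,
      ⟪(u : EuclideanSpace ℝ (Fin n)), b i⟫ * ⟪(u : EuclideanSpace ℝ (Fin n)), b i⟫ = 1 := by
    intro u
    simp_rw [← sq]
    rw [b.sum_sq_inner_left]; simp
  simp_rw [h2] at h1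
  simpa using h1

/-- The projected isotropy and centring conditions already hold for a positive combination of
finitely many distinct points of the projected support. -/
lemma exists_finite_isotropic (hn : 0 < n) (hiso : IsIsotropic μ) (hcent : sphereCentroid μ = 0) :
    ∃ (ι : Type) (_ : Fintype ι) (x : ι → H) (c : ι → ℝ), Function.Injective x ∧
      (∀ i, x i ∈ projSupport H μ) ∧ (∀ i, 0 < c i) ∧ ∑ i, c i = n ∧ ∑ i, c i • x i = 0 ∧
      ∀ y, ∑ i, (c i * ⟪x i, y⟫) • x i = y := by
  have hn' : (0 : ℝ) < n := by exact_mod_cast hn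
  have hmass := measureReal_univ_of_isIsotropic hiso
  have hu_int : Integrable (fun u : sphere (0 : EuclideanSpace ℝ (Fin n)) 1 =>
      (u : EuclideanSpace ℝ (Fin n))) μ :=
    continuous_subtype_val.integrable_of_hasCompactSupport (.of_compactSpace _)
  refine exists_finite_decomposition (H.orthogonalProjectionOnto.continuous.comp
    continuous_subtype_val) hn' hmass ?_ fun y z => ?_
  · rw [sphereCentroid, hmass] at hcent
    have hcent0 := (smul_eq_zero.1 hcent).resolve_left (inv_pos.2 hn').ne'
    have := ContinuousLinearMap.integral_comp_comm H.orthogonalProjectionOnto hu_int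
    rw [hcent0, map_zero] at this
    exact this
  · simp only [Function.comp_apply, inner_orthogonalProjectionOnto]
    exact integral_inner_mul_inner_of_isIsotropic hiso y z

end Reduction

/-! ### The inequality for sections and its equality case -/

theorem mainTheorem2 (n k : ℕ) (hk : 1 ≤ k)
    (H : Submodule ℝ (EuclideanSpace ℝ (Fin n))) (hH : Module.finrank ℝ H = k)
    (D : Set (EuclideanSpace ℝ (Fin k))) (hD : IsInscribedRegularSimplex k D)
    (μ : Measure (sphere (0 : EuclideanSpace ℝ (Fin n)) 1)) [IsFiniteMeasure μ]
    (hiso : IsIsotropic μ) (hcent : sphereCentroid μ = 0) :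
    Real.sqrt ((k : ℝ) / n) * ellNorm (polarBody D)
        ≤ ellNorm (sectionIn (polarBody (convSupport μ)) H) ∧
      (ellNorm (sectionIn (polarBody (convSupport μ)) H)
          = Real.sqrt ((k : ℝ) / n) * ellNorm (polarBody D) ↔
        ∃ L : EuclideanSpace ℝ (Fin k) ≃ₗᵢ[ℝ] H,
          sectionIn (polarBody (convSupport μ)) H
            = L '' (Real.sqrt ((n : ℝ) / k) • polarBody D)) := by
  obtain ⟨v, hveq, hv1, rfl⟩ := hD
  have hn : 0 < n := by
    have h1 := H.finrank_le
    rw [hH, finrank_euclideanSpace_fin] at h1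
    omega
  have hn' : (0 : ℝ) < n := by exact_mod_cast hn
  have hk' : (0 : ℝ) < k := by exact_mod_cast hk
  have hV : Module.finrank ℝ (EuclideanSpace ℝ (Fin k)) = k := finrank_euclideanSpace_fin
  obtain ⟨hvv, -, hvid⟩ := regularSimplex_inner hk hV v hveq hv1
  have hell := ellNorm_polarBody_regularSimplex hk v hveq hv1
  have hrhs : √((k : ℝ) / n) * ellNorm (polarBody (convexHull ℝ (Set.range v.points)))
      = √((k + 1) / n) * gaussianMaxMean (k + 1) := by
    rw [hell, ← mul_assoc, ← Real.sqrt_mul (by positivity)]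
    congr 2
    field_simp
  rw [sectionIn_polarBody_convSupport]
  set S := projSupport H μ with hS
  have hS1 : ∀ x ∈ S, ‖x‖ ≤ 1 := norm_le_one_of_mem_projSupport
  obtain ⟨ι, hι, x, c, hinj, hxS, hc, hsum, hcx, hid⟩ :=
    exists_finite_isotropic (H := H) hn hiso hcent
  have hne : Nonempty ι := by
    by_contra h
    rw [not_nonempty_iff] at h
    simp at hsum
    linarith
  have hxS' : Set.range x ⊆ S := by rintro _ ⟨i, rfl⟩; exact hxS i
  have hellx : ellNorm (polarBody (Set.range x)) = ∫ y, maxInner x y ∂(stdGaussian H) :=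
    integral_congr_ae (Filter.Eventually.of_forall (gauge_polarBody_range hc hcx))
  obtain ⟨hle, hequality⟩ := le_integral_maxInner_of_isotropic hk hH hn' hc hsum hcx hid
  have hanti := ellNorm_polarBody_anti hS1 hxS'
  rw [← hellx] at hle hequality
  rw [hrhs]
  refine ⟨hle.trans hanti, fun h => ?_, ?_⟩
  -- The `ℓ`-norm of the smaller body is squeezed, so the two bodies coincide, and the finite set is
  -- a regular simplex.
  · have h1 : ellNorm (polarBody (Set.range x)) = √((k + 1) / n) * gaussianMaxMean (k + 1) :=
      le_antisymm (hanti.trans h.le) hle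
    rw [← polarBody_eq_of_ellNorm_eq hS1 hxS' (h1.trans h.symm)]
    obtain ⟨hcard, hxx, hxy⟩ := hequality h1 hinj
    let e : Fin (k + 1) ≃ ι := (Fintype.equivFinOfCardEq hcard).symm
    have hr : √((n : ℝ) / k) * √((n : ℝ) / k) = n / k := Real.mul_self_sqrt (by positivity)
    rw [polarBody_convexHull]
    refine exists_polarBody_eq_image (hV.trans hH.symm) e (Real.sqrt_pos.2 (by positivity))
      (fun i j => ?_) hvid
    rw [hr]
    by_cases hij : i = j
    · subst hij
      rw [real_inner_self_eq_norm_sq, real_inner_self_eq_norm_sq, hxx, hv1]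
      field_simp
    · rw [hvv i j hij, hxy _ _ (e.injective.ne hij)]
      field_simp
  · rintro ⟨L, hL⟩
    rw [hL, ellNorm_image, ellNorm_smul (Real.sqrt_nonneg _), ← hrhs, ← Real.sqrt_inv, inv_div]
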